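/- Let $d\ge 1$ and $n\ge 1$ be integers. For a Borel set $A\subset\mathbb R^d$ let $\mathrm{Vol}(A)$ be its Lebesgue measure and let $$\mathrm{Per}(A)=\sup\Big\{\int_A \operatorname{div}\varphi(x)\,dx \;:\; \varphi\in C^1_c(\mathbb R^d,\mathbb R^d),\ \max_{1\le i\le d}\ \sup_{x\in\mathbb R^d}|\varphi_i(x)|\le 1\Big\}$$ be its perimeter. For a homogeneous Poisson point process $\eta$ on $\mathbb R^d$ of intensity $\lambda>0$ and a point $x\in\eta$ let $\upsilon_\eta(x)=\{z\in\mathbb R^d: \|z-x\|\le\|z-y\| \text{ for all } y\in\eta\}$ be the (Euclidean) Voronoi cell of $x$, and let $A_\eta=\bigcup_{x\in\eta\cap A}\upsilon_\eta(x)$ be the Poisson--Voronoi approximation of $A$. There is a constant $C'_{n,d}$ depending only on $n$ and $d$ such that the following holds. For every Borel set $A\subset\mathbb R^d$ with $\mathrm{Vol}(A)<\infty$ and $\mathrm{Per}(A)<\infty$ there is $\lambda_0>0$ (which may depend on $A$, $n$ and $d$) such that for every $\lambda\ge\lambda_0$ the random variable $\mathrm{Vol}(A\,\Delta\,A_\eta)$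 is almost surely finite, has a finite $n$-th moment, and satisfies $$\Big|\,\mathbb E\big[\mathrm{Vol}(A\,\Delta\,A_\eta)^n\big]-\big(\mathbb E\,\mathrm{Vol}(A\,\Delta\,A_\eta)\big)^n\Big|\ \le\ C'_{n,d}\,\mathrm{Per}(A)^{n-1}\,\lambda^{-1-(n-1)/d},$$ where $0^0=1$. -/

import Mathlib

open MeasureTheory ProbabilityTheory
open scoped ENNReal NNReal symmDiff

namespace PoissonVoronoi

/-- The divergence `∑ i, ∂φ_i / ∂x_i` of a (differentiable) vector field on `ℝ^d`. -/
noncomputable def divergence {d : ℕ}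
    (φ : EuclideanSpace ℝ (Fin d) → EuclideanSpace ℝ (Fin d))
    (x : EuclideanSpace ℝ (Fin d)) : ℝ :=
  ∑ i : Fin d, (fderiv ℝ φ x (EuclideanSpace.single i 1)) i

/-- The perimeter of `A`: the supremum of `∫_A div φ` over all continuously differentiable,
compactly supported vector fields `φ` with `max_i sup_x |φ_i(x)| ≤ 1`. The field `φ = 0` is
admissible, so the supremum is nonnegative and `ENNReal.ofReal` does not change it. -/
noncomputable def perimeter {d : ℕ} (A : Set (EuclideanSpace ℝ (Fin d))) : ℝ≥0∞ :=
  ⨆ (φ : EuclideanSpace ℝ (Fin d) → EuclideanSpace ℝ (Fin d))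
    (_ : ContDiff ℝ 1 φ) (_ : HasCompactSupport φ) (_ : ∀ x i, |φ x i| ≤ 1),
    ENNReal.ofReal (∫ x in A, divergence φ x)

/-- The Voronoi cell with nucleus `x` generated by the configuration `s`. -/
def voronoiCell {d : ℕ} (s : Set (EuclideanSpace ℝ (Fin d))) (x : EuclideanSpace ℝ (Fin d)) :
    Set (EuclideanSpace ℝ (Fin d)) :=
  {z | ∀ y ∈ s, ‖z - x‖ ≤ ‖z - y‖}

/-- The Voronoi approximation of `A`: the union of the Voronoi cells generated by `s` whose
nuclei lie in `A`. -/
def voronoiApprox {d : ℕ} (A s : Set (EuclideanSpace ℝ (Fin d))) :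
    Set (EuclideanSpace ℝ (Fin d)) :=
  ⋃ x ∈ s ∩ A, voronoiCell s x

/-- `η` is a homogeneous Poisson point process on `ℝ^d` of intensity `lam` (a random locally
finite set of points), defined on the probability space `(Ω, P)`: the number of points in a
bounded Borel set `B` is a Poisson random variable with parameter `lam * Vol(B)`, and the numbers
of points in pairwise disjoint bounded Borel sets are independent. -/
structure IsHomogeneousPoissonProcess {d : ℕ} {Ω : Type*} [MeasurableSpace Ω]
    (P : Measure Ω) (lam : ℝ) (η : Ω → Set (EuclideanSpace ℝ (Fin d))) : Prop where
  intensity_pos : 0 < lam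
  locallyFinite : ∀ (ω : Ω) (B : Set (EuclideanSpace ℝ (Fin d))),
    Bornology.IsBounded B → (η ω ∩ B).Finite
  measurable_count : ∀ B : Set (EuclideanSpace ℝ (Fin d)), MeasurableSet B →
    Bornology.IsBounded B → Measurable fun ω => (η ω ∩ B).ncard
  law_count : ∀ B : Set (EuclideanSpace ℝ (Fin d)), MeasurableSet B →
    Bornology.IsBounded B →
    P.map (fun ω => (η ω ∩ B).ncard) = poissonMeasure (lam * volume.real B).toNNReal
  indep_count : ∀ (m : ℕ) (B : Fin m → Set (EuclideanSpace ℝ (Fin d))),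
    (∀ i, MeasurableSet (B i)) → (∀ i, Bornology.IsBounded (B i)) →
    Pairwise (fun i j => Disjoint (B i) (B j)) →
    iIndepFun (fun (i : Fin m) (ω : Ω) => (η ω ∩ B i).ncard) P

end PoissonVoronoi

/-! Put `δ = lam ^ (-1/d)`, so that `lam * δ ^ d = 1`, and let `V` be the volume of the symmetric
difference. Up to ties, a point `z` is misplaced when `A` separates it from its nearest nucleus.
This is decided by `η` near the ball of radius `R(z)`, the distance to the nearest nucleus, and
`R(z)/δ` has exponential tails. Misplacements at distant points are thus nearly independent, and `E
V^(k+2)` should be close to `E V * E V^(k+1)`, with an error due to pairs of points at distance of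
order `δ`, hence smaller by a volume `δ^d`.

To prove this, write the powers of `V` as integrals over points `z, w_0, …, w_k` and replace each
misplacement indicator by its restriction to the event that the nearest nucleus is closer than half
the relevant distance. The restricted quantities at `z` and at the `w_i` depend on `η` in disjoint
regions and are independent (`lintegral_close_mul`). The price is the event `reach`, that the ball
of radius `2R` about one point contains the other; integrating it over the other point costs `δ^d (1
+ R/δ)^d`. Carrying the weights `(1 + R/δ)^q` inside the volume makes the error another moment of
the same kind, with a larger `q`. This gives `lintegral_totalMisfit_pow_le` and its converse
`mul_lintegral_totalMisfit_pow_le`.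

The perimeter enters through the bound by `Per(A) ‖h‖` on the volume that `A` loses under
translation by `h` (`measure_sdiff_translate_le`); with the exponential tails it bounds the weighted
means by a multiple of `Per(A) δ` (`lintegral_totalMisfit_le`). If moreover `δ^d ≤ c Per(A) δ`,
which `exists_pow_le_perimeter` gives for small `δ` and is why `lam` must be large, induction bounds
the `m`-th moments by multiples of `(Per(A) δ)^m`. A second induction bounds the difference between
`E V^n` and `(E V)^n` by a multiple of `(Per(A) δ)^(n-1) δ^d`. -/

namespace PoissonVoronoi

/-! ### Translation differences of a set of finite perimeter -/

section Covariogram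

variable {d : ℕ}

local notation "E" => EuclideanSpace ℝ (Fin d)

/-- The average of `ψ` over the segment from `x` to `x - h`. -/
noncomputable def segmentAverage (ψ : E → ℝ) (h x : E) : ℝ :=
  ∫ t in (0 : ℝ)..1, ψ (x - t • h)

theorem hasFDerivAt_segmentAverage {ψ : E → ℝ} (hψ : ContDiff ℝ 1 ψ) (hc : HasCompactSupport ψ)
    (h x : E) :
    HasFDerivAt (segmentAverage ψ h) (∫ t in (0 : ℝ)..1, fderiv ℝ ψ (x - t • h)) x := by
  have hcont : Continuous (fderiv ℝ ψ) := hψ.continuous_fderiv one_ne_zero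
  obtain ⟨M, hM⟩ := (hc.fderiv ℝ).exists_bound_of_continuous hcont
  have hψc := hψ.continuous
  refine hasFDerivAt_integral_of_dominated_of_fderiv_le'' (bound := fun _ => M)
    (F := fun x t => ψ (x - t • h)) (F' := fun x t => fderiv ℝ ψ (x - t • h))
    Filter.univ_mem ?_ ?_ ?_ ?_ ?_ ?_
  · exact Filter.Eventually.of_forall fun y => by
      have : Continuous fun t : ℝ => ψ (y - t • h) := by fun_prop
      exact this.aestronglyMeasurable
  · have : Continuous fun t : ℝ => ψ (x - t • h) := by fun_prop
    exact this.intervalIntegrable _ _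
  · have : Continuous fun t : ℝ => fderiv ℝ ψ (x - t • h) := by fun_prop
    exact this.aestronglyMeasurable
  · exact Filter.Eventually.of_forall fun t y _ => hM _
  · exact intervalIntegrable_const
  · refine Filter.Eventually.of_forall fun t y _ => ?_
    have h1 := (hψ.differentiable one_ne_zero (y - t • h)).hasFDerivAt
    exact (hasFDerivAt_comp_sub _).2 h1

theorem contDiff_segmentAverage {ψ : E → ℝ} (hψ : ContDiff ℝ 1 ψ) (hc : HasCompactSupport ψ)
    (h : E) : ContDiff ℝ 1 (segmentAverage ψ h) := by
  have hcont : Continuous (fderiv ℝ ψ) := hψ.continuous_fderiv one_ne_zero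
  refine contDiff_one_iff_hasFDerivAt.2 ⟨_, ?_, fun x => hasFDerivAt_segmentAverage hψ hc h x⟩
  refine intervalIntegral.continuous_parametric_intervalIntegral_of_continuous' ?_ 0 1
  simp only [Function.uncurry_def]
  fun_prop

/-- The fundamental theorem of calculus along the segment. It lets a finite difference of `ψ` appear
as a divergence. -/
theorem fderiv_segmentAverage_apply {ψ : E → ℝ} (hψ : ContDiff ℝ 1 ψ) (hc : HasCompactSupport ψ)
    (h x : E) : fderiv ℝ (segmentAverage ψ h) x h = ψ x - ψ (x - h) := by
  have hcont : Continuous (fderiv ℝ ψ) := hψ.continuous_fderiv one_ne_zero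
  have hc1 : Continuous fun t : ℝ => fderiv ℝ ψ (x - t • h) := by fun_prop
  rw [(hasFDerivAt_segmentAverage hψ hc h x).fderiv,
    ContinuousLinearMap.intervalIntegral_apply (hc1.intervalIntegrable _ _)]
  have hd : ∀ t ∈ Set.uIcc (0 : ℝ) 1, HasDerivAt (fun t : ℝ => - ψ (x - t • h))
      (fderiv ℝ ψ (x - t • h) h) t := by
    intro t _
    have h1 := (hψ.differentiable one_ne_zero (x - t • h)).hasFDerivAt
    have h2 : HasDerivAt (fun t : ℝ => x - t • h) (-h) t := by
      simpa using ((hasDerivAt_id t).smul_const h).const_sub x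
    have h3 := (h1.comp_hasDerivAt t h2).neg
    simp only [map_neg, neg_neg] at h3
    exact h3
  rw [intervalIntegral.integral_eq_sub_of_hasDerivAt hd
    ((hc1.clm_apply continuous_const).intervalIntegrable _ _)]
  simp only [one_smul, zero_smul, sub_zero]
  ring

theorem abs_segmentAverage_le {ψ : E → ℝ} (hψ1 : ∀ x, |ψ x| ≤ 1) (h x : E) :
    |segmentAverage ψ h x| ≤ 1 := by
  simpa [segmentAverage] using intervalIntegral.norm_integral_le_of_norm_le_const (a := (0 : ℝ)) (b := 1)
    (f := fun t => ψ (x - t • h)) (C := 1) fun t _ => hψ1 _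

theorem hasCompactSupport_segmentAverage {ψ : E → ℝ} (hc : HasCompactSupport ψ) (h : E) :
    HasCompactSupport (segmentAverage ψ h) := by
  obtain ⟨r, hr⟩ := hc.isCompact.isBounded.subset_closedBall (0 : E)
  refine HasCompactSupport.intro (isCompact_closedBall (0 : E) (r + ‖h‖)) fun x hx => ?_
  have : ∀ t ∈ Set.uIcc (0 : ℝ) 1, ψ (x - t • h) = 0 := by
    intro t ht
    rw [Set.uIcc_of_le zero_le_one] at ht
    by_contra hne
    have h1 := hr (subset_tsupport _ hne)
    apply hx
    rw [mem_closedBall_zero_iff] at h1 ⊢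
    calc ‖x‖ = ‖(x - t • h) + t • h‖ := by simp
      _ ≤ ‖x - t • h‖ + ‖t • h‖ := norm_add_le _ _
      _ ≤ r + ‖h‖ := by
        rw [norm_smul, Real.norm_of_nonneg ht.1]
        nlinarith [norm_nonneg h, ht.2]
  rw [segmentAverage, intervalIntegral.integral_congr (g := fun _ => (0 : ℝ)) this]
  simp

theorem divergence_smul_const {g : E → ℝ} {x : E} (hg : DifferentiableAt ℝ g x) (u : E) :
    divergence (fun y => g y • u) x = fderiv ℝ g x u := by
  rw [divergence, (hg.hasFDerivAt.smul_const u).fderiv]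
  simp only [ContinuousLinearMap.smulRight_apply, PiLp.smul_apply, smul_eq_mul]
  conv_rhs => rw [← (EuclideanSpace.basisFun (Fin d) ℝ).sum_repr u]
  simp [mul_comm]

/-- Test the perimeter with the field `segmentAverage ψ h • u`, where `u = h / ‖h‖`. Its components
are bounded by `‖u‖ = 1`, and its divergence is the finite difference divided by `‖h‖`. -/
theorem integral_sub_translate_le_perimeter (A : Set E)
    {ψ : E → ℝ} (hψ : ContDiff ℝ 1 ψ)
    (hc : HasCompactSupport ψ) (hψ1 : ∀ x, |ψ x| ≤ 1) (h : E) :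
    ENNReal.ofReal (∫ x in A, (ψ x - ψ (x - h))) ≤ perimeter A * ‖h‖ₑ := by
  rcases eq_or_ne h 0 with rfl | hh
  · simp
  have hn : 0 < ‖h‖ := norm_pos_iff.2 hh
  set u : E := ‖h‖⁻¹ • h with hu
  have hu1 : ‖u‖ = 1 := norm_smul_inv_norm (𝕜 := ℝ) hh
  have key : ENNReal.ofReal (∫ x in A, divergence (fun y => segmentAverage ψ h y • u) x)
      ≤ perimeter A := by
    refine le_iSup_of_le (fun y => segmentAverage ψ h y • u) ?_
    refine le_iSup_of_le ((contDiff_segmentAverage hψ hc h).smul contDiff_const) ?_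
    refine le_iSup_of_le ((hasCompactSupport_segmentAverage hc h).smul_right) ?_
    refine le_iSup_of_le (fun x i => ?_) le_rfl
    rw [PiLp.smul_apply, smul_eq_mul, abs_mul]
    have h2 : |u i| ≤ 1 := by
      have := PiLp.norm_apply_le u i
      rwa [hu1] at this
    exact mul_le_one₀ (abs_segmentAverage_le hψ1 h x) (abs_nonneg _) h2
  have heq : ∀ x, divergence (fun y => segmentAverage ψ h y • u) x
      = ‖h‖⁻¹ * (ψ x - ψ (x - h)) := fun x => by
    rw [divergence_smul_const ((contDiff_segmentAverage hψ hc h).differentiable one_ne_zero x), hu,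
      map_smul, fderiv_segmentAverage_apply hψ hc, smul_eq_mul]
  simp only [heq] at key
  rw [integral_const_mul, ENNReal.ofReal_mul (by positivity), ENNReal.ofReal_inv_of_pos hn,
    ofReal_norm] at key
  rw [← ENNReal.div_le_iff (by simpa using hh) (by simp), ENNReal.div_eq_inv_mul]
  exact key

open scoped Manifold in
-- After a change of variables, the previous bound controls `∫_A ψ - ∫_{A-h} ψ`. A smooth `ψ` close
-- to the indicator of `A \ (A - h)` turns this into the volume.
theorem measure_sdiff_translate_le {A : Set E} (hA : MeasurableSet A) (hfin : volume A < ∞)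
    (h : E) : volume {x | x ∈ A ∧ x + h ∉ A} ≤ perimeter A * ‖h‖ₑ := by
  set D : Set E := {x | x ∈ A ∧ x + h ∉ A} with hD
  have hBm : MeasurableSet {x : E | x + h ∈ A} := measurable_id.add_const h hA
  have hDm : MeasurableSet D := hA.inter hBm.compl
  have hDfin : volume D ≠ ∞ := ((measure_mono fun x hx => hx.1).trans_lt hfin).ne
  have hBfin : volume {x : E | x + h ∈ A} < ∞ := by
    have := measure_preimage_add_right (volume : Measure E) h A
    rw [show {x : E | x + h ∈ A} = (fun x => x + h) ⁻¹' A from rfl, this]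
    exact hfin
  refine ENNReal.le_of_forall_pos_le_add fun ε hε _ => ?_
  obtain ⟨K, hKD, hK, hKε⟩ := hDm.exists_isCompact_lt_add hDfin
    (ε := (ε / 2 : ℝ≥0)) (by simpa using hε.ne')
  obtain ⟨U, hKU, hU, hUε⟩ := hK.exists_isOpen_lt_add (μ := volume)
    (ε := (ε / 2 : ℝ≥0)) (by simpa using hε.ne')
  -- `U` may be unbounded; cutting it with a ball gives `ψ` compact support.
  obtain ⟨r, hr⟩ := hK.isBounded.subset_ball (0 : E)
  obtain ⟨ψ, hψd, hψr, hψs, hψ1⟩ := exists_contMDiff_support_eq_eq_one_iff (n := 1) 𝓘(ℝ, E)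
    (hU.inter Metric.isOpen_ball) hK.isClosed (Set.subset_inter hKU hr)
  have hψd : ContDiff ℝ 1 ψ := hψd.contDiff
  have hrange : ∀ x, ψ x ∈ Set.Icc (0 : ℝ) 1 := fun x => hψr ⟨x, rfl⟩
  have hcs : HasCompactSupport ψ :=
    HasCompactSupport.intro (isCompact_closedBall (0 : E) r) fun x hx => by
      have : x ∉ Function.support ψ := fun h' => hx <| by
        rw [hψs] at h'; exact Metric.ball_subset_closedBall h'.2
      simpa using this
  have habs : ∀ x, |ψ x| ≤ 1 := fun x => by
    rw [abs_of_nonneg (hrange x).1]; exact (hrange x).2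
  have hmain := integral_sub_translate_le_perimeter A hψd hcs habs h
  have hint : Integrable ψ := hψd.continuous.integrable_of_hasCompactSupport hcs
  have hint' : Integrable fun x => ψ (x - h) := hint.comp_sub_right h
  have hshift : ∫ x in A, ψ (x - h) = ∫ x in {x : E | x + h ∈ A}, ψ x := by
    rw [← integral_indicator hA, ← integral_indicator hBm,
      ← integral_add_right_eq_self (fun x => A.indicator (fun x => ψ (x - h)) x) h]
    congr 1 with x
    simp [Set.indicator]
  rw [integral_sub hint.integrableOn hint'.integrableOn, hshift] at hmain
  set B : Set E := {x | x + h ∈ A} with hB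
  have hKA : ∀ x ∈ K, x ∈ A ∧ x ∉ B := fun x hx => hKD hx
  have hUf : volume U ≠ ∞ := (hUε.trans_le le_top).ne
  have hKf : volume K ≠ ∞ := hK.measure_lt_top.ne
  have hUKm : MeasurableSet (U \ K) := hU.measurableSet.diff hK.measurableSet
  have hUK : volume (U \ K) ≤ (ε / 2 : ℝ≥0) := by
    rw [measure_sdiff hKU hK.measurableSet.nullMeasurableSet hKf]
    exact tsub_le_iff_left.2 hUε.le
  have hUKf : volume (U \ K) ≠ ∞ := (hUK.trans_lt ENNReal.coe_lt_top).ne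
  -- The difference of the two integrands is `1` on `K`, at least `-1` on `U \ K`, and `0` off `U`.
  have hlow : volume.real K - volume.real (U \ K) ≤ (∫ x in A, ψ x) - ∫ x in B, ψ x := by
    rw [← integral_indicator_one hK.measurableSet, ← integral_indicator_one hUKm,
      ← integral_indicator hA, ← integral_indicator hBm,
      ← integral_sub ((integrable_indicator_iff hK.measurableSet).2 (integrableOn_const hKf))
        ((integrable_indicator_iff hUKm).2 (integrableOn_const hUKf)),
      ← integral_sub (hint.indicator hA) (hint.indicator hBm)]
    refine integral_mono
      (((integrable_indicator_iff hK.measurableSet).2 (integrableOn_const hKf)).sub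
        ((integrable_indicator_iff hUKm).2 (integrableOn_const hUKf)))
      ((hint.indicator hA).sub (hint.indicator hBm)) fun x => ?_
    by_cases hxK : x ∈ K
    · obtain ⟨hxA, hxB⟩ := hKA x hxK
      simp [hxK, hxA, hxB, (hψ1 x).1 hxK]
    · have h0 := hrange x
      by_cases hxU : x ∈ U
      · have : (0 : ℝ) ≤ A.indicator ψ x := Set.indicator_nonneg (fun y _ => (hrange y).1) x
        have h2 : B.indicator ψ x ≤ 1 := by
          by_cases hxB : x ∈ B
          · simpa [hxB] using h0.2
          · simp [hxB]
        simp only [Set.indicator, hxK, hxU, Set.mem_sdiff, not_false_eq_true, and_self, if_true,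
          if_false, Pi.one_apply] at this h2 ⊢
        linarith
      · have : ψ x = 0 := by
          have : x ∉ Function.support ψ := fun h' => hxU <| by rw [hψs] at h'; exact h'.1
          simpa using this
        simp [Set.indicator, hxK, hxU, this]
  calc volume D ≤ volume K + (ε / 2 : ℝ≥0) := hKε.le
    _ ≤ (ENNReal.ofReal (volume.real K - volume.real (U \ K)) + volume (U \ K))
        + (ε / 2 : ℝ≥0) := by
      gcongr
      rw [← ofReal_measureReal hKf, ← ofReal_measureReal hUKf,
        ← tsub_le_iff_right, ENNReal.ofReal_sub _ measureReal_nonneg]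
    _ ≤ (perimeter A * ‖h‖ₑ + (ε / 2 : ℝ≥0)) + (ε / 2 : ℝ≥0) := by
      gcongr
      exact (ENNReal.ofReal_le_ofReal hlow).trans hmain
    _ = perimeter A * ‖h‖ₑ + ε := by
      rw [add_assoc, ← ENNReal.coe_add, add_halves]

end Covariogram

/-! ### A lower bound for the perimeter, and the volume of separated pairs -/

section Isoperimetry

variable {d : ℕ}

local notation "E" => EuclideanSpace ℝ (Fin d)

/-- Follow a point of `A` in the ball along the steps `h` until it first leaves `A`: the last
position inside lies in `D`. Since `‖h‖ > 2r`, the translated balls are disjoint, so the parts of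
the ball with different exit times occupy disjoint parts of `D`. -/
theorem measure_inter_closedBall_le {A : Set E} (hA : MeasurableSet A) (hfin : volume A < ∞)
    (x h : E) {r : ℝ} (hr : 0 < r) (hh : ‖h‖ = 3 * r) :
    volume (A ∩ Metric.closedBall x r) ≤ volume {x | x ∈ A ∧ x + h ∉ A} := by
  set D : Set E := {x | x ∈ A ∧ x + h ∉ A} with hD
  let B : ℕ → Set E := fun k => Metric.closedBall (x + (k : ℝ) • h) r
  have hBm : ∀ k, MeasurableSet (B k) := fun k => Metric.isClosed_closedBall.measurableSet
  have hpre : ∀ k : ℕ, (fun y => y + (k : ℝ) • h) ⁻¹' B k = B 0 := fun k => by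
    ext y; simp [B, Metric.mem_closedBall, dist_eq_norm]
  have hdisj : Pairwise (Function.onFun Disjoint B) := fun k l hkl => by
    refine Metric.closedBall_disjoint_closedBall ?_
    rw [dist_add_left, dist_eq_norm, ← sub_smul, norm_smul, hh]
    have h1 : (1 : ℝ) ≤ ‖(k : ℝ) - l‖ := by
      rw [Real.norm_eq_abs]
      have : (1 : ℤ) ≤ |(k : ℤ) - l| := Int.one_le_abs (by omega)
      exact_mod_cast this
    nlinarith
  have htr : ∀ (k : ℕ) (S : Set E),
      volume (B 0 ∩ (fun y => y + (k : ℝ) • h) ⁻¹' S) = volume (B k ∩ S) := fun k S => by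
    rw [← hpre k, ← Set.preimage_inter, measure_preimage_add_right]
  have hsum : ∀ S : Set E, MeasurableSet S → ∑' k, volume (B k ∩ S) ≤ volume S := fun S hS => by
    rw [← measure_iUnion (fun k l hkl => (hdisj hkl).mono Set.inter_subset_left
      Set.inter_subset_left) fun k => (hBm k).inter hS]
    exact measure_mono (Set.iUnion_subset fun k => Set.inter_subset_right)
  have hDm : MeasurableSet D := hA.inter (measurable_id.add_const h hA.compl)
  set N : Set E := {y | y ∈ B 0 ∧ ∀ k : ℕ, y + (k : ℝ) • h ∈ A} with hN
  -- Points that never leave `A` have infinitely many disjoint copies in `A`, which has finite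
  -- volume.
  have hN0 : volume N = 0 := by
    by_contra hne
    have h1 : ∑' _ : ℕ, volume N ≤ volume A := by
      refine le_trans (ENNReal.tsum_le_tsum fun k => ?_) (hsum A hA)
      rw [← htr k A]
      exact measure_mono fun y hy => ⟨hy.1, hy.2 k⟩
    rw [ENNReal.tsum_const_eq_top_of_ne_zero hne] at h1
    exact absurd hfin (not_lt.2 h1)
  have hcover : A ∩ Metric.closedBall x r ⊆
      (⋃ k : ℕ, B 0 ∩ (fun y => y + (k : ℝ) • h) ⁻¹' D) ∪ N := by
    rintro y ⟨hyA, hyB⟩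
    have hyB0 : y ∈ B 0 := by simpa [B] using hyB
    by_cases hall : ∀ k : ℕ, y + (k : ℝ) • h ∈ A
    · exact Or.inr ⟨hyB0, hall⟩
    · left
      push Not at hall
      classical
      have hs := Nat.find_spec hall
      have hmin := fun m => Nat.find_min hall (m := m)
      -- The first exit is not at time `0` because `y ∈ A`; so `m` is the last time inside.
      obtain ⟨m, hm⟩ : ∃ m, Nat.find hall = m + 1 := Nat.exists_eq_succ_of_ne_zero fun h0 => by
        rw [h0] at hs; simp [hyA] at hs
      rw [hm] at hs hmin
      refine Set.mem_iUnion.2 ⟨m, hyB0, not_not.1 (hmin m (Nat.lt_succ_self m)), ?_⟩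
      simpa [add_smul, add_assoc] using hs
  calc volume (A ∩ Metric.closedBall x r) ≤ _ := measure_mono hcover
    _ ≤ _ := measure_union_le _ _
    _ = volume (⋃ k : ℕ, B 0 ∩ (fun y => y + (k : ℝ) • h) ⁻¹' D) := by rw [hN0, add_zero]
    _ ≤ ∑' k : ℕ, volume (B 0 ∩ (fun y => y + (k : ℝ) • h) ⁻¹' D) := measure_iUnion_le _
    _ = ∑' k, volume (B k ∩ D) := by simp only [htr]
    _ ≤ volume D := hsum D hDm

/-- A quantitative lower bound of the perimeter of a set of positive volume; `r` is a scale at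
which the set fills half of a ball. -/
theorem exists_pow_le_perimeter (hd : 1 ≤ d) {A : Set E} (hA : MeasurableSet A)
    (hfin : volume A < ∞) (hpos : volume A ≠ 0) :
    ∃ r : ℝ≥0, 0 < r ∧
      (r : ℝ≥0∞) ^ d * volume (Metric.ball (0 : E) 1) ≤ 6 * (perimeter A * r) := by
  have hne : (ae (volume.restrict A)).NeBot := by
    rw [ae_neBot]; exact fun h => hpos (Measure.restrict_eq_zero.1 h)
  -- At a Lebesgue density point of `A`, all small balls are more than half filled.
  obtain ⟨x, hx⟩ := (Besicovitch.ae_tendsto_measure_inter_div (volume : Measure E) A).exists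
  have hev := hx.eventually (lt_mem_nhds ENNReal.one_half_lt_one)
  obtain ⟨r, hr, hr0⟩ := (hev.and self_mem_nhdsWithin).exists
  have hr0 : 0 < r := hr0
  lift r to ℝ≥0 using hr0.le
  have hr0' : 0 < r := by exact_mod_cast hr0
  refine ⟨r, hr0', ?_⟩
  have hb0 : volume (Metric.closedBall x r) ≠ 0 := (Metric.measure_closedBall_pos _ _ hr0).ne'
  have hbt : volume (Metric.closedBall x r) ≠ ∞ := measure_closedBall_lt_top.ne
  -- Length `3r` is what the disjointness of the balls requires; with the half filling it gives `6 =
  -- 2 * 3`.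
  set h : E := EuclideanSpace.single ⟨0, hd⟩ (3 * (r : ℝ)) with hh
  have hnorm : ‖h‖ = 3 * r := by simp [hh]
  have henorm : ‖h‖ₑ = 3 * r := by
    rw [← ofReal_norm, hnorm, ENNReal.ofReal_mul (by norm_num)]; simp
  have h1 := (measure_inter_closedBall_le hA hfin x h hr0 hnorm).trans
    (measure_sdiff_translate_le hA hfin h)
  have h2 : volume (Metric.closedBall x r) ≤ 2 * volume (A ∩ Metric.closedBall x r) := by
    have := ((ENNReal.lt_div_iff_mul_lt (Or.inl hb0) (Or.inl hbt)).1 hr).le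
    calc volume (Metric.closedBall x r) = 2 * (2⁻¹ * volume (Metric.closedBall x r)) := by
          rw [← mul_assoc, ENNReal.mul_inv_cancel (by simp) (by simp), one_mul]
      _ ≤ _ := by
        gcongr
  calc (r : ℝ≥0∞) ^ d * volume (Metric.ball (0 : E) 1) = volume (Metric.closedBall x r) := by
        rw [Measure.addHaar_closedBall _ _ hr0.le, finrank_euclideanSpace_fin,
          ENNReal.ofReal_pow hr0.le, ENNReal.ofReal_coe_nnreal]
    _ ≤ 2 * (perimeter A * ‖h‖ₑ) := h2.trans (by gcongr)
    _ = 6 * (perimeter A * r) := by rw [henorm]; ring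

theorem perimeter_eq_zero_of_measure_zero {A : Set E} (h0 : volume A = 0) :
    perimeter A = 0 := by
  simp [perimeter, Measure.restrict_eq_zero.2 h0]

theorem measurableSet_mem_xor {A : Set E} (hA : MeasurableSet A) :
    MeasurableSet {p : E × E | ¬ (p.1 ∈ A ↔ p.1 + p.2 ∈ A)} :=
  ((measurable_fst hA).iff ((measurable_fst.add measurable_snd) hA)).compl

/-- Points entering `A` under `h` are translates of points leaving it under `-h`, so both halves
obey the one-sided bound. -/
theorem measure_xor_translate_le {A : Set E} (hA : MeasurableSet A) (hfin : volume A < ∞)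
    (h : E) : volume {x | ¬ (x ∈ A ↔ x + h ∈ A)} ≤ 2 * (perimeter A * ‖h‖ₑ) := by
  have h1 := measure_sdiff_translate_le hA hfin h
  have h2 := measure_sdiff_translate_le hA hfin (-h)
  have h3 : volume {x | x ∉ A ∧ x + h ∈ A} = volume {x | x ∈ A ∧ x + -h ∉ A} := by
    rw [← measure_preimage_add_right volume h {x | x ∈ A ∧ x + -h ∉ A}]
    congr 1 with x
    simp [and_comm]
  rw [enorm_neg, ← h3] at h2
  calc _ ≤ volume ({x | x ∈ A ∧ x + h ∉ A} ∪ {x | x ∉ A ∧ x + h ∈ A}) :=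
        measure_mono fun x hx => by
          simp only [Set.mem_union, Set.mem_ofPred_eq] at hx ⊢; tauto
    _ ≤ _ := (measure_union_le _ _).trans (add_le_add h1 h2)
    _ = _ := by ring

/-- The volume of the pairs of points at distance less than `t` which `A` separates. -/
theorem lintegral_measure_xor_ball_le {A : Set E} (hA : MeasurableSet A) (hfin : volume A < ∞)
    (t : ℝ≥0) :
    ∫⁻ z : E, volume {x | ¬ (z ∈ A ↔ x ∈ A) ∧ x ∈ Metric.ball z t}
      ≤ 2 * (perimeter A * t) * volume (Metric.ball (0 : E) t) := by
  have hm := measurableSet_mem_xor hA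
  let F : E × E → ℝ≥0∞ := Set.indicator {p | ¬ (p.1 ∈ A ↔ p.1 + p.2 ∈ A)} 1
  have hF : Measurable F := measurable_one.indicator hm
  have h1 : ∀ z : E, volume {x | ¬ (z ∈ A ↔ x ∈ A) ∧ x ∈ Metric.ball z t}
      = ∫⁻ h in Metric.ball (0 : E) t, F (z, h) := fun z => by
    rw [← measure_preimage_add volume z]
    have hs : MeasurableSet {h | ¬ (z ∈ A ↔ z + h ∈ A)} := measurable_prodMk_left hm
    have h2 : ∀ h : E, F (z, h)
        = Set.indicator {h | ¬ (z ∈ A ↔ z + h ∈ A)} 1 h := fun h => rfl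
    simp_rw [h2]
    rw [lintegral_indicator_one hs, Measure.restrict_apply hs]
    congr 1 with h
    simp [Metric.mem_ball, dist_eq_norm]
  simp_rw [h1]
  -- Integrating over `z` first, at a fixed displacement `h`, brings in the translation bound.
  rw [lintegral_lintegral_swap (f := fun z h => F (z, h)) hF.aemeasurable]
  calc _ ≤ ∫⁻ h in Metric.ball (0 : E) t, 2 * (perimeter A * t) := by
        refine setLIntegral_mono measurable_const fun h hh => ?_
        have h2 : ∀ z : E, F (z, h) = Set.indicator {z | ¬ (z ∈ A ↔ z + h ∈ A)} 1 z := fun z => rfl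
        simp_rw [h2]
        rw [lintegral_indicator_one (s := {z | ¬ (z ∈ A ↔ z + h ∈ A)}) (measurable_prodMk_right hm)]
        refine (measure_xor_translate_le hA hfin h).trans ?_
        gcongr
        have : ‖h‖₊ < t := by simpa [← NNReal.coe_lt_coe] using hh
        exact ENNReal.coe_le_coe.2 this.le
    _ = _ := by rw [setLIntegral_const]

end Isoperimetry

/-! ### Void events and spatial independence -/

section Voids

variable {d : ℕ} {Ω : Type*}

local notation "E" => EuclideanSpace ℝ (Fin d)

/-- The event that `η` has no point in `C`. -/
def voidEvent (η : Ω → Set E) (C : Set E) : Set Ω := {ω | η ω ∩ C = ∅}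

/-- The void events of bounded Borel subsets of `B`. -/
def voidEvents (η : Ω → Set E) (B : Set E) : Set (Set Ω) :=
  {s | ∃ C, MeasurableSet C ∧ Bornology.IsBounded C ∧ C ⊆ B ∧ voidEvent η C = s}

/-- The information on `η` that is visible inside `B`. -/
@[reducible] def localSigma (η : Ω → Set E) (B : Set E) : MeasurableSpace Ω :=
  MeasurableSpace.generateFrom (voidEvents η B)

theorem voidEvent_inter (η : Ω → Set E) (C D : Set E) :
    voidEvent η C ∩ voidEvent η D = voidEvent η (C ∪ D) := by
  ext ω; simp [voidEvent, Set.inter_union_distrib_left]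

/-- Avoiding `C` and avoiding `D` is avoiding `C ∪ D`. Independence of the generated σ-algebras can
therefore be checked on void probabilities. -/
theorem isPiSystem_voidEvents (η : Ω → Set E) (B : Set E) : IsPiSystem (voidEvents η B) := by
  rintro _ ⟨C, hC, hCb, hCB, rfl⟩ _ ⟨D, hD, hDb, hDB, rfl⟩ _
  exact ⟨C ∪ D, hC.union hD, hCb.union hDb, Set.union_subset hCB hDB, (voidEvent_inter η C D).symm⟩

theorem localSigma_mono (η : Ω → Set E) {B B' : Set E} (h : B ⊆ B') :
    localSigma η B ≤ localSigma η B' :=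
  MeasurableSpace.generateFrom_mono fun _ ⟨C, hC, hb, hCB, hs⟩ => ⟨C, hC, hb, hCB.trans h, hs⟩

theorem measurableSet_localSigma_voidEvent (η : Ω → Set E) {B C : Set E} (hC : MeasurableSet C)
    (hb : Bornology.IsBounded C) (hCB : C ⊆ B) : MeasurableSet[localSigma η B] (voidEvent η C) :=
  MeasurableSpace.measurableSet_generateFrom ⟨C, hC, hb, hCB, rfl⟩

/-- The distance to the nearest point of `η` in `C`, cut off at `s`, is visible in the ball of
radius `s`. -/
theorem measurable_localSigma_min_infEDist (η : Ω → Set E) {C : Set E} (hC : MeasurableSet C)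
    (z : E) (s : ℝ≥0∞) :
    Measurable[localSigma η (Metric.eball z s)]
      fun ω => min (Metric.infEDist z (η ω ∩ C)) s := by
  let _ : MeasurableSpace Ω := localSigma η (Metric.eball z s)
  refine measurable_of_Iio fun t => ?_
  rcases lt_or_ge s t with hst | hst
  · convert MeasurableSet.univ
    ext ω; simp [hst]
  -- The distance is below `t` exactly when `η` meets `C` within distance `t`. The balls of radius
  -- `n` are needed because generators are void events of bounded sets and `t` may be infinite.
  · have : (fun ω => min (Metric.infEDist z (η ω ∩ C)) s) ⁻¹' Set.Iio t =
        ⋃ n : ℕ, (voidEvent η (C ∩ Metric.eball z t ∩ Metric.ball z n))ᶜ := by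
      ext ω
      simp only [Set.mem_preimage, Set.mem_Iio, min_lt_iff, not_lt.2 hst, or_false,
        Metric.infEDist_lt_iff, Set.mem_iUnion, Set.mem_compl_iff, voidEvent, Set.mem_ofPred_eq,
        ← Set.nonempty_iff_ne_empty, ← ne_eq]
      constructor
      · rintro ⟨y, ⟨hy, hyC⟩, hyt⟩
        obtain ⟨n, hn⟩ := exists_nat_gt (dist y z)
        exact ⟨n, y, hy, ⟨hyC, by rwa [Metric.mem_eball, edist_comm]⟩, hn⟩
      · rintro ⟨n, y, hy, ⟨hyC, hyt⟩, -⟩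
        exact ⟨y, ⟨hy, hyC⟩, by rwa [Metric.mem_eball, edist_comm] at hyt⟩
    rw [this]
    refine MeasurableSet.iUnion fun n => MeasurableSet.compl ?_
    exact measurableSet_localSigma_voidEvent η
      ((hC.inter Metric.isOpen_eball.measurableSet).inter Metric.isOpen_ball.measurableSet)
      (Metric.isBounded_ball.subset Set.inter_subset_right)
      fun y hy => lt_of_lt_of_le hy.1.2 hst

variable [MeasurableSpace Ω] {P : Measure Ω} {lam : ℝ}
  {η : Ω → Set (EuclideanSpace ℝ (Fin d))}

namespace IsHomogeneousPoissonProcess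

theorem voidEvent_eq (hη : IsHomogeneousPoissonProcess P lam η) {C : Set E}
    (hb : Bornology.IsBounded C) :
    voidEvent η C = (fun ω => (η ω ∩ C).ncard) ⁻¹' {0} := by
  ext ω
  simp [voidEvent, Set.ncard_eq_zero (hη.locallyFinite ω C hb)]

theorem measurableSet_voidEvent (hη : IsHomogeneousPoissonProcess P lam η) {C : Set E}
    (hC : MeasurableSet C) (hb : Bornology.IsBounded C) : MeasurableSet (voidEvent η C) := by
  rw [hη.voidEvent_eq hb]
  exact hη.measurable_count C hC hb (measurableSet_singleton 0)

theorem measure_voidEvent (hη : IsHomogeneousPoissonProcess P lam η) {C : Set E}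
    (hC : MeasurableSet C) (hb : Bornology.IsBounded C) :
    P (voidEvent η C) = ENNReal.ofReal (Real.exp (-(lam * volume.real C))) := by
  rw [hη.voidEvent_eq hb, ← Measure.map_apply (hη.measurable_count C hC hb)
    (measurableSet_singleton 0), hη.law_count C hC hb, poissonMeasure_singleton]
  have := hη.intensity_pos
  simp [Real.coe_toNNReal _ (mul_nonneg this.le (measureReal_nonneg (μ := volume) (s := C)))]

theorem localSigma_le (hη : IsHomogeneousPoissonProcess P lam η) (B : Set E) :
    localSigma η B ≤ ‹MeasurableSpace Ω› :=
  MeasurableSpace.generateFrom_le fun _ ⟨_, hC, hb, _, hs⟩ => hs ▸ hη.measurableSet_voidEvent hC hb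

/-- Disjoint regions carry independent information. -/
theorem indep_localSigma [IsProbabilityMeasure P] (hη : IsHomogeneousPoissonProcess P lam η)
    {B B' : Set E} (hBB : Disjoint B B') : Indep (localSigma η B) (localSigma η B') P := by
  refine IndepSets.indep' (fun _ ⟨_, hC, hb, _, hs⟩ => hs ▸ hη.measurableSet_voidEvent hC hb)
    (fun _ ⟨_, hC, hb, _, hs⟩ => hs ▸ hη.measurableSet_voidEvent hC hb)
    (isPiSystem_voidEvents η B) (isPiSystem_voidEvents η B') ?_
  rw [IndepSets_iff]
  rintro _ _ ⟨C, hC, hCb, hCB, rfl⟩ ⟨D, hD, hDb, hDB, rfl⟩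
  rw [voidEvent_inter, hη.measure_voidEvent (hC.union hD) (hCb.union hDb),
    hη.measure_voidEvent hC hCb, hη.measure_voidEvent hD hDb,
    ← ENNReal.ofReal_mul (Real.exp_nonneg _), ← Real.exp_add,
    measureReal_union (hBB.mono hCB hDB) hD hCb.measure_lt_top.ne hDb.measure_lt_top.ne]
  ring_nf

theorem measurable_infEDist (hη : IsHomogeneousPoissonProcess P lam η) {C : Set E}
    (hC : MeasurableSet C) (z : E) : Measurable fun ω => Metric.infEDist z (η ω ∩ C) := by
  have := (measurable_localSigma_min_infEDist η hC z ∞).mono (hη.localSigma_le _) le_rfl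
  simpa using this

/-- Joint measurability holds because the distance is continuous in the point and measurable in `ω`.
-/
theorem measurable_infEDist_prod (hη : IsHomogeneousPoissonProcess P lam η) {C : Set E}
    (hC : MeasurableSet C) : Measurable fun p : E × Ω => Metric.infEDist p.1 (η p.2 ∩ C) :=
  measurable_uncurry_of_continuous_of_measurable (u := fun z ω => Metric.infEDist z (η ω ∩ C))
    (fun _ => Metric.continuous_infEDist) fun z => hη.measurable_infEDist hC z

/-- The two events are independent, and `1 - exp (-t) ≤ t` bounds the probability of hitting `C`. -/
theorem measure_voidEvent_inter_compl_le [IsProbabilityMeasure P]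
    (hη : IsHomogeneousPoissonProcess P lam η) {B C : Set E}
    (hB : MeasurableSet B) (hBb : Bornology.IsBounded B) (hC : MeasurableSet C)
    (hCb : Bornology.IsBounded C) (hBC : Disjoint B C) :
    P (voidEvent η B ∩ (voidEvent η C)ᶜ) ≤
      ENNReal.ofReal (Real.exp (-(lam * volume.real B))) * (ENNReal.ofReal lam * volume C) := by
  have hi := (hη.indep_localSigma hBC)
  rw [Indep_iff] at hi
  rw [hi _ _ (measurableSet_localSigma_voidEvent η hB hBb subset_rfl)
    (MeasurableSet.compl (measurableSet_localSigma_voidEvent η hC hCb subset_rfl)),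
    hη.measure_voidEvent hB hBb]
  gcongr
  rw [prob_compl_eq_one_sub (hη.measurableSet_voidEvent hC hCb), hη.measure_voidEvent hC hCb,
    ← ENNReal.ofReal_one, ← ENNReal.ofReal_sub _ (Real.exp_nonneg _),
    ← ofReal_measureReal hCb.measure_lt_top.ne, ← ENNReal.ofReal_mul hη.intensity_pos.le]
  refine ENNReal.ofReal_le_ofReal ?_
  linarith [Real.add_one_le_exp (-(lam * volume.real C))]

end IsHomogeneousPoissonProcess

end Voids

/-! ### Voronoi cells through distances to the nuclei -/

section Cells

variable {d : ℕ}

local notation "E" => EuclideanSpace ℝ (Fin d)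

theorem exists_edist_eq_infEDist {s : Set E}
    (hs : ∀ B, Bornology.IsBounded B → (s ∩ B).Finite) (hne : s.Nonempty) (z : E) :
    ∃ x ∈ s, edist z x = Metric.infEDist z s := by
  obtain ⟨y, hy⟩ := hne
  obtain ⟨x, hx, hmin⟩ := Set.exists_min_image _ (fun x => edist z x)
    (hs (Metric.closedBall z (dist z y)) Metric.isBounded_closedBall)
    ⟨y, hy, by simp [dist_comm]⟩
  refine ⟨x, hx.1, le_antisymm (Metric.le_infEDist.2 fun w hw => ?_)
    (Metric.infEDist_le_edist_of_mem hx.1)⟩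
  by_cases hwB : w ∈ Metric.closedBall z (dist z y)
  · exact hmin w ⟨hw, hwB⟩
  · have h1 : edist z x ≤ edist z y := hmin y ⟨hy, by simp [dist_comm]⟩
    refine h1.trans ?_
    rw [Metric.mem_closedBall, not_le, dist_comm w z] at hwB
    rw [edist_dist, edist_dist]
    exact ENNReal.ofReal_le_ofReal hwB.le

/-- Local finiteness makes the distance to `s ∩ A` attained, so membership compares two distances.
The finiteness clause excludes the empty configuration, where both distances are `∞` but there is no
cell. -/
theorem mem_voronoiApprox_iff {s : Set E}
    (hs : ∀ B, Bornology.IsBounded B → (s ∩ B).Finite) (A : Set E) (z : E) :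
    z ∈ voronoiApprox A s ↔
      Metric.infEDist z (s ∩ A) ≤ Metric.infEDist z s ∧ Metric.infEDist z s < ∞ := by
  constructor
  · intro hz
    simp only [voronoiApprox, Set.mem_iUnion] at hz
    obtain ⟨x, hx, hxz⟩ := hz
    have h1 : Metric.infEDist z (s ∩ A) ≤ edist z x := Metric.infEDist_le_edist_of_mem hx
    refine ⟨Metric.le_infEDist.2 fun y hy => h1.trans ?_,
      (Metric.infEDist_le_edist_of_mem hx.1).trans_lt (edist_lt_top _ _)⟩
    rw [edist_dist, edist_dist, dist_eq_norm, dist_eq_norm]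
    exact ENNReal.ofReal_le_ofReal (hxz y hy)
  · rintro ⟨h1, h2⟩
    have hne : (s ∩ A).Nonempty := by
      rw [Set.nonempty_iff_ne_empty]
      intro h0
      rw [h0, Metric.infEDist_empty, top_le_iff] at h1
      exact h2.ne h1
    obtain ⟨x, hx, hxz⟩ := exists_edist_eq_infEDist (s := s ∩ A)
      (fun B hB => (hs B hB).subset fun y hy => ⟨hy.1.1, hy.2⟩) hne z
    refine Set.mem_iUnion₂.2 ⟨x, hx, fun y hy => ?_⟩
    have h3 : edist z x ≤ edist z y := by
      rw [hxz]; exact h1.trans (Metric.infEDist_le_edist_of_mem hy)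
    rw [edist_dist, edist_dist, dist_eq_norm, dist_eq_norm,
      ENNReal.ofReal_le_ofReal_iff (norm_nonneg _)] at h3
    exact h3

end Cells

/-! ### The weighted misplaced volume and its mean -/

section Misfit

variable {d : ℕ} {Ω : Type*}

local notation "E" => EuclideanSpace ℝ (Fin d)

/-- The weight `(1 + ρ / δ) ^ q` if the cells misplace `z`, where `α` is the distance from `z` to
the nearest nucleus in `A` and `ρ` the distance to the nearest nucleus; `0` otherwise. -/
noncomputable def misfitWeight (A : Set E) (δ : ℝ≥0) (q : ℕ) : E × ℝ≥0∞ × ℝ≥0∞ → ℝ≥0∞ :=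
  Set.indicator {x | ¬ (x.1 ∈ A ↔ (x.2.1 ≤ x.2.2 ∧ x.2.2 < ∞))} fun x => (1 + x.2.2 / δ) ^ q

/-- The weight of the point `z` in the symmetric difference of `A` and its approximation. -/
noncomputable def localMisfit (A : Set E) (δ : ℝ≥0) (q : ℕ) (η : Ω → Set E) (z : E) (ω : Ω) :
    ℝ≥0∞ :=
  misfitWeight A δ q (z, Metric.infEDist z (η ω ∩ A), Metric.infEDist z (η ω))

/-- The weighted volume of the symmetric difference of `A` and its approximation. -/
noncomputable def totalMisfit (A : Set E) (δ : ℝ≥0) (q : ℕ) (η : Ω → Set E) (ω : Ω) : ℝ≥0∞ :=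
  ∫⁻ z, localMisfit A δ q η z ω

theorem measurable_misfitWeight {A : Set E} (hA : MeasurableSet A) (δ : ℝ≥0) (q : ℕ) :
    Measurable (misfitWeight A δ q) := by
  refine Measurable.indicator (by fun_prop) ?_
  have h1 : MeasurableSet {x : E × ℝ≥0∞ × ℝ≥0∞ | x.2.1 ≤ x.2.2} :=
    measurableSet_le (by fun_prop) (by fun_prop)
  have h2 : MeasurableSet {x : E × ℝ≥0∞ × ℝ≥0∞ | x.2.2 < ∞} :=
    measurableSet_lt (by fun_prop) (by fun_prop)
  exact ((measurable_fst hA).iff (h1.inter h2)).compl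

theorem localMisfit_zero_le_one (A : Set E) (δ : ℝ≥0) (η : Ω → Set E) (z : E) (ω : Ω) :
    localMisfit A δ 0 η z ω ≤ 1 := by
  simp only [localMisfit, misfitWeight, Set.indicator]
  split_ifs <;> simp

/-- This absorbs the powers of `1 + R/δ` produced by later estimates into a larger exponent. -/
theorem localMisfit_mul_weight (A : Set E) (δ : ℝ≥0) (q p : ℕ) (η : Ω → Set E) (z : E) (ω : Ω) :
    localMisfit A δ q η z ω * (1 + Metric.infEDist z (η ω) / δ) ^ p
      = localMisfit A δ (q + p) η z ω := by
  simp only [localMisfit, misfitWeight, Set.indicator]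
  split_ifs
  · rw [pow_add]
  · simp

theorem localMisfit_mono (A : Set E) (δ : ℝ≥0) {q p : ℕ} (h : q ≤ p) (η : Ω → Set E) (z : E)
    (ω : Ω) : localMisfit A δ q η z ω ≤ localMisfit A δ p η z ω := by
  obtain ⟨k, rfl⟩ := Nat.exists_eq_add_of_le h
  rw [← localMisfit_mul_weight]
  exact le_mul_of_one_le_right' (one_le_pow₀ le_self_add)

theorem localMisfit_le_weight (A : Set E) (δ : ℝ≥0) (q : ℕ) (η : Ω → Set E) (z : E) (ω : Ω) :
    localMisfit A δ q η z ω ≤ (1 + Metric.infEDist z (η ω) / δ) ^ q := by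
  simp only [localMisfit, misfitWeight, Set.indicator]
  split_ifs <;> simp

theorem totalMisfit_mono (A : Set E) (δ : ℝ≥0) {q p : ℕ} (h : q ≤ p) (η : Ω → Set E) (ω : Ω) :
    totalMisfit A δ q η ω ≤ totalMisfit A δ p η ω :=
  lintegral_mono fun z => localMisfit_mono A δ h η z ω

theorem totalMisfit_zero {A : Set E} (hA : MeasurableSet A) (δ : ℝ≥0) {η : Ω → Set E} {ω : Ω}
    (hs : ∀ B, Bornology.IsBounded B → (η ω ∩ B).Finite) :
    totalMisfit A δ 0 η ω = volume (A ∆ voronoiApprox A (η ω)) := by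
  have hset : A ∆ voronoiApprox A (η ω) = {z | ¬ (z ∈ A ↔
      (Metric.infEDist z (η ω ∩ A) ≤ Metric.infEDist z (η ω) ∧ Metric.infEDist z (η ω) < ∞))} := by
    ext z
    rw [Set.mem_symmDiff, Set.mem_ofPred_eq, ← mem_voronoiApprox_iff hs]
    tauto
  have hm : MeasurableSet {z | ¬ (z ∈ A ↔
      (Metric.infEDist z (η ω ∩ A) ≤ Metric.infEDist z (η ω) ∧ Metric.infEDist z (η ω) < ∞))} := by
    have h1 : MeasurableSet {z | Metric.infEDist z (η ω ∩ A) ≤ Metric.infEDist z (η ω)} :=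
      measurableSet_le (by fun_prop) (by fun_prop)
    have h2 : MeasurableSet {z | Metric.infEDist z (η ω) < ∞} :=
      measurableSet_lt (by fun_prop) (by fun_prop)
    exact (MeasurableSet.iff hA (h1.inter h2)).compl
  rw [hset, ← lintegral_indicator_one hm]
  refine lintegral_congr fun z => ?_
  simp [localMisfit, misfitWeight, Set.indicator]

/-- The points within distance `(k + 1) * δ` of `z`, but not within `k * δ`, which are separated
from `z` by `A`. -/
def separatedShell (A : Set E) (δ : ℝ≥0) (z : E) (k : ℕ) : Set E :=
  {x | ¬ (z ∈ A ↔ x ∈ A) ∧ x ∈ Metric.ball z ((k + 1 : ℕ) * δ : ℝ≥0)} \ Metric.ball z (k * δ)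

/-- Only the term `k = ⌊R/δ⌋` is used: there is no nucleus within `k δ`, some nucleus separated from
`z` by `A` lies within `(k+1) δ`, and the weight is at most `(k+2)^q`. -/
theorem localMisfit_le_tsum {η : Ω → Set E} {A : Set E} {δ : ℝ≥0} (hδ : 0 < δ) (q : ℕ) (z : E) (ω : Ω)
    (hfin : Metric.infEDist z (η ω) < ∞) :
    localMisfit A δ q η z ω ≤ ∑' k : ℕ, Set.indicator
      (voidEvent η (Metric.ball z (k * δ)) ∩ (voidEvent η (separatedShell A δ z k))ᶜ)
      (fun _ => ((k : ℝ≥0∞) + 2) ^ q) ω := by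
  simp only [localMisfit, misfitWeight]
  set R := Metric.infEDist z (η ω) with hR
  set α := Metric.infEDist z (η ω ∩ A) with hα
  rw [Set.indicator]
  split_ifs with hmis
  swap
  · exact zero_le
  simp only [Set.mem_ofPred_eq, hfin, and_true] at hmis
  set k := ⌊R.toReal / δ⌋₊ with hk
  have hδr : (0 : ℝ) < δ := hδ
  have hk1 : (k : ℝ) * δ ≤ R.toReal := (le_div_iff₀ hδr).1 (Nat.floor_le (by positivity))
  have hk2 : R.toReal < ((k + 1 : ℕ) : ℝ) * δ := by
    push_cast
    exact (div_lt_iff₀ hδr).1 (Nat.lt_floor_add_one _)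
  have hk1' : ((k * δ : ℝ≥0) : ℝ≥0∞) ≤ R := by
    rw [← ENNReal.ofReal_toReal hfin.ne, ← ENNReal.ofReal_coe_nnreal]
    exact ENNReal.ofReal_le_ofReal (by push_cast; exact hk1)
  have hk2' : R < (((k + 1 : ℕ) * δ : ℝ≥0) : ℝ≥0∞) := by
    rw [← ENNReal.ofReal_toReal hfin.ne, ← ENNReal.ofReal_coe_nnreal]
    exact (ENNReal.ofReal_lt_ofReal_iff_of_nonneg ENNReal.toReal_nonneg).2 (by push_cast at hk2 ⊢; exact hk2)
  have hfar : ∀ y ∈ η ω, y ∉ Metric.ball z (k * δ) := fun y hy hyb => by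
    have h1 : R ≤ edist z y := Metric.infEDist_le_edist_of_mem hy
    rw [Metric.mem_ball, dist_comm, ← edist_lt_ofReal] at hyb
    refine absurd (hk1'.trans h1) (not_le.2 ?_)
    rw [← ENNReal.ofReal_coe_nnreal]; push_cast; exact hyb
  -- For `z ∈ A`, misplacement is the strict inequality `R < α`, and a nucleus closer than `α` is
  -- outside `A`. For `z ∉ A` it is `α ≤ R`, and a nucleus in `A` is near enough.
  obtain ⟨y, hy, hsep, hyd⟩ : ∃ y ∈ η ω, ¬ (z ∈ A ↔ y ∈ A) ∧
      edist z y < (((k + 1 : ℕ) * δ : ℝ≥0) : ℝ≥0∞) := by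
    by_cases hz : z ∈ A
    · have hlt : R < α := by simpa [hz] using hmis
      obtain ⟨y, hy, hyd⟩ := Metric.infEDist_lt_iff.1 (lt_min hlt hk2')
      refine ⟨y, hy, fun h => ?_, hyd.trans_le (min_le_right _ _)⟩
      exact (Metric.infEDist_le_edist_of_mem (x := z) (s := η ω ∩ A) ⟨hy, h.1 hz⟩).not_gt
        (hyd.trans_le (min_le_left _ _))
    · have hle : α ≤ R := by simpa [hz] using hmis
      obtain ⟨y, hy, hyd⟩ := Metric.infEDist_lt_iff.1 (hle.trans_lt hk2')
      exact ⟨y, hy.1, fun h => hz (h.2 hy.2), hyd⟩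
  refine le_trans ?_ (ENNReal.le_tsum k)
  rw [Set.indicator_of_mem]
  · refine pow_le_pow_left' ?_ q
    have h1 : R / δ ≤ (k : ℝ≥0∞) + 1 := by
      refine ENNReal.div_le_of_le_mul (hk2'.le.trans_eq ?_)
      push_cast; ring
    calc 1 + R / δ ≤ 1 + ((k : ℝ≥0∞) + 1) := by gcongr
      _ = k + 2 := by ring
  · refine ⟨?_, ?_⟩
    · rw [voidEvent, Set.mem_ofPred_eq, Set.eq_empty_iff_forall_notMem]
      exact fun y hy => hfar y hy.1 hy.2
    · rw [voidEvent, Set.mem_compl_iff, Set.mem_ofPred_eq, ← ne_eq, ← Set.nonempty_iff_ne_empty]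
      refine ⟨y, hy, ⟨hsep, ?_⟩, hfar y hy⟩
      rw [Metric.mem_ball, dist_comm, ← edist_lt_ofReal, ENNReal.ofReal_coe_nnreal]
      exact hyd

variable [MeasurableSpace Ω] {P : Measure Ω} {lam : ℝ}
  {η : Ω → Set (EuclideanSpace ℝ (Fin d))} {A : Set (EuclideanSpace ℝ (Fin d))} {δ : ℝ≥0}

/-- By the normalisation the right side is `κ k^d`, with `κ` the volume of the unit ball; `k ≤ k^d`
since `d ≥ 1`, and a bound linear in `k` suffices for summability. -/
theorem mul_measureReal_ball (hδ : lam * (δ : ℝ) ^ d = 1) (hd : 1 ≤ d) (z : E) (k : ℕ) :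
    volume.real (Metric.ball (0 : E) 1) * k ≤ lam * volume.real (Metric.ball z (k * δ)) := by
  have : Nonempty (Fin d) := ⟨⟨0, hd⟩⟩
  have hk : (0 : ℝ) ≤ k * δ := by positivity
  rw [Measure.real, Measure.real, Measure.addHaar_ball _ _ hk, finrank_euclideanSpace_fin,
    ENNReal.toReal_mul, ENNReal.toReal_ofReal (by positivity), mul_pow]
  have h1 : (k : ℝ) ≤ (k : ℝ) ^ d := by exact_mod_cast Nat.le_self_pow (by omega) k
  calc _ ≤ (volume (Metric.ball (0 : E) 1)).toReal * (k : ℝ) ^ d := by gcongr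
    _ = (lam * (δ : ℝ) ^ d) * ((volume (Metric.ball (0 : E) 1)).toReal * (k : ℝ) ^ d) := by
      rw [hδ, one_mul]
    _ = _ := by ring

theorem ofReal_exp_neg_ball_le (hδ : lam * (δ : ℝ) ^ d = 1) (hd : 1 ≤ d) (z : E) (k : ℕ) :
    ENNReal.ofReal (Real.exp (-(lam * volume.real (Metric.ball z (k * δ))))) ≤
      ENNReal.ofReal (Real.exp (-volume.real (Metric.ball (0 : E) 1) * k)) := by
  refine ENNReal.ofReal_le_ofReal (Real.exp_le_exp.2 ?_)
  have := mul_measureReal_ball hδ hd z k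
  linarith

namespace IsHomogeneousPoissonProcess

theorem measurable_infEDist_univ (hη : IsHomogeneousPoissonProcess P lam η) :
    Measurable fun p : E × Ω => Metric.infEDist p.1 (η p.2) := by
  simpa using hη.measurable_infEDist_prod MeasurableSet.univ

theorem measurable_localMisfit (hη : IsHomogeneousPoissonProcess P lam η) (hA : MeasurableSet A)
    (δ : ℝ≥0) (q : ℕ) : Measurable fun p : E × Ω => localMisfit A δ q η p.1 p.2 :=
  (measurable_misfitWeight hA δ q).comp (measurable_fst.prodMk
    ((hη.measurable_infEDist_prod hA).prodMk hη.measurable_infEDist_univ))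

theorem measurable_totalMisfit (hη : IsHomogeneousPoissonProcess P lam η) (hA : MeasurableSet A)
    (δ : ℝ≥0) (q : ℕ) : Measurable (totalMisfit A δ q η) :=
  (hη.measurable_localMisfit hA δ q).lintegral_prod_left'

/-- An infinite distance means no nuclei at all, and the void probabilities of growing balls tend to
`0`. -/
theorem ae_infEDist_lt_top (hη : IsHomogeneousPoissonProcess P lam η)
    (hδ : lam * (δ : ℝ) ^ d = 1) (hd : 1 ≤ d) (z : E) :
    ∀ᵐ ω ∂P, Metric.infEDist z (η ω) < ∞ := by
  have hκ : 0 < volume.real (Metric.ball (0 : E) 1) :=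
    ENNReal.toReal_pos (Metric.measure_ball_pos _ _ one_pos).ne' measure_ball_lt_top.ne
  have hlim : Filter.Tendsto (fun k : ℕ => ENNReal.ofReal
      (Real.exp (-volume.real (Metric.ball (0 : E) 1) * k))) Filter.atTop (nhds 0) := by
    rw [← ENNReal.ofReal_zero]
    refine (ENNReal.continuous_ofReal.tendsto 0).comp ?_
    refine Real.tendsto_exp_atBot.comp ?_
    exact tendsto_natCast_atTop_atTop.const_mul_atTop_of_neg (neg_lt_zero.2 hκ)
  rw [ae_iff]
  refine le_antisymm (ge_of_tendsto' hlim fun k => ?_) zero_le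
  refine le_trans ?_ (ofReal_exp_neg_ball_le hδ hd z k)
  rw [← hη.measure_voidEvent measurableSet_ball Metric.isBounded_ball]
  refine measure_mono fun ω hω => ?_
  simp only [Set.mem_ofPred_eq, not_lt, top_le_iff] at hω
  by_contra hne
  obtain ⟨y, hy, -⟩ := Set.nonempty_iff_ne_empty.2 hne
  exact ((Metric.infEDist_le_edist_of_mem hy).trans_lt (edist_lt_top z y)).ne hω

end IsHomogeneousPoissonProcess

theorem measurableSet_separatedShell (hA : MeasurableSet A) (δ : ℝ≥0) (z : E) (k : ℕ) :
    MeasurableSet (separatedShell A δ z k) :=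
  (((MeasurableSet.const _).iff hA).compl.inter measurableSet_ball).diff measurableSet_ball

theorem isBounded_separatedShell (A : Set E) (δ : ℝ≥0) (z : E) (k : ℕ) :
    Bornology.IsBounded (separatedShell A δ z k) :=
  Metric.isBounded_ball.subset fun _ hx => hx.1.2

/-- The constant in the bound of the mean of `totalMisfit`. -/
noncomputable def meanConst (d q : ℕ) : ℝ≥0∞ :=
  ∑' k : ℕ, (((k : ℝ≥0∞) + 2) ^ q * ENNReal.ofReal (Real.exp
    (-volume.real (Metric.ball (0 : EuclideanSpace ℝ (Fin d)) 1) * k))) *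
    (2 * ((k + 1) ^ (d + 1) * volume (Metric.ball (0 : EuclideanSpace ℝ (Fin d)) 1)))

theorem meanConst_ne_top (d q : ℕ) : meanConst d q ≠ ∞ := by
  set κ := volume.real (Metric.ball (0 : EuclideanSpace ℝ (Fin d)) 1) with hκ
  have hκ0 : 0 < κ :=
    ENNReal.toReal_pos (Metric.measure_ball_pos _ _ one_pos).ne' measure_ball_lt_top.ne
  have hv : volume (Metric.ball (0 : EuclideanSpace ℝ (Fin d)) 1) = ENNReal.ofReal κ :=
    (ofReal_measureReal measure_ball_lt_top.ne).symm
  have hterm : ∀ k : ℕ, (((k : ℝ≥0∞) + 2) ^ q * ENNReal.ofReal (Real.exp (-κ * k))) *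
      (2 * ((k + 1) ^ (d + 1) * volume (Metric.ball (0 : EuclideanSpace ℝ (Fin d)) 1)))
      = ENNReal.ofReal ((((k : ℝ) + 2) ^ q * Real.exp (-κ * k)) *
        (2 * ((k + 1) ^ (d + 1) * κ))) := fun k => by
    rw [hv, ENNReal.ofReal_mul (by positivity), ENNReal.ofReal_mul (by positivity),
      ENNReal.ofReal_mul (by positivity), ENNReal.ofReal_mul (by positivity),
      ENNReal.ofReal_pow (by positivity), ENNReal.ofReal_pow (by positivity),
      ENNReal.ofReal_add (by positivity) (by positivity),
      ENNReal.ofReal_add (by positivity) (by positivity)]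
    simp
  have hsum : Summable fun k : ℕ => (((k : ℝ) + 2) ^ q * Real.exp (-κ * k)) *
        (2 * ((k + 1) ^ (d + 1) * κ)) := by
    -- Shifting the index by `2` bounds both polynomial factors by powers of one variable `k + 2`;
    -- the constant `exp (κ * 2)` undoes the shift in the exponential.
    have h1 := (Real.summable_pow_mul_exp_neg_nat_mul (q + (d + 1)) hκ0).comp_injective
      (add_left_injective 2)
    refine Summable.of_nonneg_of_le (fun k => by positivity) (fun k => ?_)
      (h1.mul_left (2 * κ * Real.exp (κ * 2)))
    simp only [Function.comp_apply]
    push_cast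
    have h2 : Real.exp (κ * 2) * Real.exp (-κ * ((k : ℝ) + 2)) = Real.exp (-κ * k) := by
      rw [← Real.exp_add]; ring_nf
    have h3 : ((k : ℝ) + 1) ^ (d + 1) ≤ ((k : ℝ) + 2) ^ (d + 1) := by gcongr; norm_num
    calc _ ≤ (((k : ℝ) + 2) ^ q * Real.exp (-κ * k)) * (2 * (((k : ℝ) + 2) ^ (d + 1) * κ)) := by
          gcongr
      _ = _ := by rw [← h2, pow_add]; ring
  rw [meanConst]
  simp only [← hκ]
  simp_rw [hterm]
  rw [← ENNReal.ofReal_tsum_of_nonneg (fun k => by positivity) hsum]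
  exact ENNReal.ofReal_ne_top

/-- At shell `k` the probability is at most `exp (-κ k)` times `lam` times the separated volume.
Integrated over `z`, that volume is at most a multiple of `Per(A) ((k+1) δ)^(d+1)`; `lam * δ^d = 1`
leaves `Per(A) δ` times a convergent series. -/
theorem IsHomogeneousPoissonProcess.lintegral_totalMisfit_le [IsProbabilityMeasure P]
    (hη : IsHomogeneousPoissonProcess P lam η)
    (hδ : lam * (δ : ℝ) ^ d = 1) (hd : 1 ≤ d) (hA : MeasurableSet A) (hfin : volume A < ∞)
    (q : ℕ) :
    ∫⁻ ω, totalMisfit A δ q η ω ∂P ≤ meanConst d q * (perimeter A * δ) := by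
  have : Nonempty (Fin d) := ⟨⟨0, hd⟩⟩
  have hδ0 : 0 < δ := by
    rw [pos_iff_ne_zero]; rintro rfl
    simp [zero_pow (by omega : d ≠ 0)] at hδ
  set κ := volume.real (Metric.ball (0 : E) 1) with hκ
  have hpt : ∀ z : E, ∫⁻ ω, localMisfit A δ q η z ω ∂P ≤
      ∑' k : ℕ, (((k : ℝ≥0∞) + 2) ^ q * ENNReal.ofReal (Real.exp (-κ * k))) *
        (ENNReal.ofReal lam *
          volume {x | ¬ (z ∈ A ↔ x ∈ A) ∧ x ∈ Metric.ball z ((k + 1 : ℕ) * δ : ℝ≥0)}) := fun z => by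
    have hmeas : ∀ k : ℕ, MeasurableSet (voidEvent η (Metric.ball z (k * δ)) ∩
        (voidEvent η (separatedShell A δ z k))ᶜ) := fun k =>
      (hη.measurableSet_voidEvent measurableSet_ball Metric.isBounded_ball).inter
        (hη.measurableSet_voidEvent (measurableSet_separatedShell hA δ z k)
          (isBounded_separatedShell A δ z k)).compl
    calc _ ≤ ∫⁻ ω, ∑' k : ℕ, Set.indicator
          (voidEvent η (Metric.ball z (k * δ)) ∩ (voidEvent η (separatedShell A δ z k))ᶜ)
          (fun _ => ((k : ℝ≥0∞) + 2) ^ q) ω ∂P := by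
          refine lintegral_mono_ae ?_
          filter_upwards [hη.ae_infEDist_lt_top hδ hd z] with ω hω
          exact localMisfit_le_tsum hδ0 q z ω hω
      _ = ∑' k : ℕ, ((k : ℝ≥0∞) + 2) ^ q * P (voidEvent η (Metric.ball z (k * δ)) ∩
            (voidEvent η (separatedShell A δ z k))ᶜ) := by
          rw [lintegral_tsum fun k => (measurable_const.indicator (hmeas k)).aemeasurable]
          refine tsum_congr fun k => ?_
          rw [lintegral_indicator_const (hmeas k)]
      _ ≤ _ := by
          refine ENNReal.tsum_le_tsum fun k => ?_
          rw [mul_assoc]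
          gcongr
          refine (hη.measure_voidEvent_inter_compl_le measurableSet_ball Metric.isBounded_ball
            (measurableSet_separatedShell hA δ z k) (isBounded_separatedShell A δ z k)
            Set.disjoint_sdiff_right).trans ?_
          exact mul_le_mul' (ofReal_exp_neg_ball_le hδ hd z k)
            (mul_le_mul_right (measure_mono Set.sdiff_subset) _)
  have hxor : ∀ k : ℕ, Measurable fun z : E =>
      volume {x | ¬ (z ∈ A ↔ x ∈ A) ∧ x ∈ Metric.ball z ((k + 1 : ℕ) * δ : ℝ≥0)} := fun k => by
    refine measurable_measure_prodMk_left (ν := volume)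
      (s := {p : E × E | ¬ (p.1 ∈ A ↔ p.2 ∈ A) ∧ p.2 ∈ Metric.ball p.1 ((k + 1 : ℕ) * δ : ℝ≥0)}) ?_
    refine ((measurable_fst hA).iff (measurable_snd hA)).compl.inter ?_
    exact measurableSet_lt (by fun_prop) measurable_const
  calc ∫⁻ ω, totalMisfit A δ q η ω ∂P = ∫⁻ z, ∫⁻ ω, localMisfit A δ q η z ω ∂P := by
        simp only [totalMisfit]
        rw [lintegral_lintegral_swap (f := fun ω z => localMisfit A δ q η z ω)]
        exact ((hη.measurable_localMisfit hA δ q).comp measurable_swap).aemeasurable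
    _ ≤ _ := lintegral_mono hpt
    _ = ∑' k : ℕ, (((k : ℝ≥0∞) + 2) ^ q * ENNReal.ofReal (Real.exp (-κ * k))) *
        (ENNReal.ofReal lam * ∫⁻ z : E,
          volume {x | ¬ (z ∈ A ↔ x ∈ A) ∧ x ∈ Metric.ball z ((k + 1 : ℕ) * δ : ℝ≥0)}) := by
        rw [lintegral_tsum fun k => (((hxor k).const_mul _).const_mul _).aemeasurable]
        refine tsum_congr fun k => ?_
        rw [lintegral_const_mul _ ((hxor k).const_mul _), lintegral_const_mul _ (hxor k)]
    _ ≤ ∑' k : ℕ, ((((k : ℝ≥0∞) + 2) ^ q * ENNReal.ofReal (Real.exp (-κ * k))) *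
        (2 * ((k + 1) ^ (d + 1) * volume (Metric.ball (0 : E) 1)))) * (perimeter A * δ) := by
        refine ENNReal.tsum_le_tsum fun k => ?_
        rw [mul_assoc _ (2 * _)]
        refine mul_le_mul_right ?_ _
        have hlδ : ENNReal.ofReal lam * (δ : ℝ≥0∞) ^ d = 1 := by
          rw [← ENNReal.ofReal_coe_nnreal, ← ENNReal.ofReal_pow (by positivity),
            ← ENNReal.ofReal_mul hη.intensity_pos.le, hδ, ENNReal.ofReal_one]
        calc _ ≤ ENNReal.ofReal lam * _ := by
              exact mul_le_mul_right (lintegral_measure_xor_ball_le hA hfin _) _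
          _ = (ENNReal.ofReal lam * (δ : ℝ≥0∞) ^ d) * (2 * ((k + 1) ^ (d + 1) *
                volume (Metric.ball (0 : E) 1)) * (perimeter A * δ)) := by
              rw [Measure.addHaar_ball _ _ (by positivity), finrank_euclideanSpace_fin,
                ENNReal.ofReal_pow (by positivity), ENNReal.ofReal_coe_nnreal]
              push_cast
              rw [mul_pow]
              ring
          _ = _ := by rw [hlδ, one_mul]
    _ = _ := by rw [ENNReal.tsum_mul_right, meanConst]

end Misfit

/-! ### Integrals of products over finite powers of a space -/

theorem lintegral_fin_prod {X : Type*} [MeasureSpace X] [SigmaFinite (volume : Measure X)] :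
    ∀ {n : ℕ} (f : Fin n → X → ℝ≥0∞), (∀ i, Measurable (f i)) →
      ∫⁻ w : Fin n → X, ∏ i, f i (w i) = ∏ i, ∫⁻ x, f i x
  | 0, f, _ => by simp [volume_pi]
  | n + 1, f, hf => by
    have hm := (volume_preserving_piFinSuccAbove (fun _ : Fin (n + 1) => X) 0).symm
    have hF : Measurable fun w : Fin (n + 1) → X => ∏ i, f i (w i) :=
      Finset.measurable_prod _ fun i _ => (hf i).comp (measurable_pi_apply i)
    rw [← hm.lintegral_comp hF]
    simp_rw [Fin.prod_univ_succ]
    have h1 : ∀ p : X × (Fin n → X), f 0 ((MeasurableEquiv.piFinSuccAbove (fun _ => X) 0).symm p 0) *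
        ∏ i : Fin n, f i.succ ((MeasurableEquiv.piFinSuccAbove (fun _ => X) 0).symm p i.succ)
        = f 0 p.1 * ∏ i : Fin n, f i.succ (p.2 i) := fun p => by
      simp [MeasurableEquiv.piFinSuccAbove]
    simp_rw [h1]
    have hG : Measurable fun w : Fin n → X => ∏ i, f i.succ (w i) :=
      Finset.measurable_prod _ fun i _ => (hf i.succ).comp (measurable_pi_apply i)
    rw [Measure.volume_eq_prod, lintegral_prod_mul (hf 0).aemeasurable hG.aemeasurable,
      lintegral_fin_prod _ fun i => hf i.succ]

theorem lintegral_fin_prod_mul {X : Type*} [MeasureSpace X] [SigmaFinite (volume : Measure X)]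
    {k : ℕ} {f g : X → ℝ≥0∞} (hf : Measurable f) (hg : Measurable g) (i : Fin (k + 1)) :
    ∫⁻ w : Fin (k + 1) → X, (∏ j, f (w j)) * g (w i) = (∫⁻ x, f x) ^ k * ∫⁻ x, f x * g x := by
  let F : Fin (k + 1) → X → ℝ≥0∞ := fun j x => f x * if j = i then g x else 1
  have h1 : ∀ w : Fin (k + 1) → X, (∏ j, f (w j)) * g (w i) = ∏ j, F j (w j) := fun w => by
    simp only [F]
    rw [Finset.prod_mul_distrib, Finset.prod_ite_eq' Finset.univ i fun j => g (w j)]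
    simp
  simp_rw [h1]
  rw [lintegral_fin_prod F fun j => hf.mul (by split_ifs; exacts [hg, measurable_const]),
    Fin.prod_univ_succAbove _ i]
  simp [F, Fin.succAbove_ne, mul_comm]

theorem lintegral_fin_prod_pow {X : Type*} [MeasureSpace X] [SigmaFinite (volume : Measure X)]
    {k : ℕ} {f : X → ℝ≥0∞} (hf : Measurable f) :
    ∫⁻ w : Fin k → X, ∏ j, f (w j) = (∫⁻ x, f x) ^ k := by
  rw [lintegral_fin_prod (fun _ => f) fun _ => hf]
  simp

/-! ### Localisation of misfits and the cost of interaction -/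

section Decoupling

variable {d : ℕ} {Ω : Type*}

local notation "E" => EuclideanSpace ℝ (Fin d)

/-- Indicator of the event that the ball around `z` of twice the distance to the nearest nucleus
reaches `u`. -/
noncomputable def reach (η : Ω → Set E) (z u : E) (ω : Ω) : ℝ≥0∞ :=
  if edist z u ≤ 2 * Metric.infEDist z (η ω) then 1 else 0

/-- The misfit at `z`, restricted to the event that a nucleus is closer than `s`. -/
noncomputable def closeMisfit (A : Set E) (δ : ℝ≥0) (q : ℕ) (η : Ω → Set E) (s : ℝ≥0∞) (z : E)
    (ω : Ω) : ℝ≥0∞ :=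
  if Metric.infEDist z (η ω) < s then localMisfit A δ q η z ω else 0

theorem closeMisfit_le (A : Set E) (δ : ℝ≥0) (q : ℕ) (η : Ω → Set E) (s : ℝ≥0∞) (z : E)
    (ω : Ω) : closeMisfit A δ q η s z ω ≤ localMisfit A δ q η z ω := by
  unfold closeMisfit; split_ifs <;> simp

/-- If a nucleus is closer than `s`, truncating both distances at `s` changes neither `R` nor the
truth of `α ≤ R`, and truncated distances are visible in the ball. -/
theorem measurable_localSigma_closeMisfit {A : Set E} (hA : MeasurableSet A) (δ : ℝ≥0) (q : ℕ)
    (η : Ω → Set E) (s : ℝ≥0∞) (z : E) :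
    Measurable[localSigma η (Metric.eball z s)] (closeMisfit A δ q η s z) := by
  let _ : MeasurableSpace Ω := localSigma η (Metric.eball z s)
  have h1 := measurable_localSigma_min_infEDist η hA z s
  have h2 := measurable_localSigma_min_infEDist η MeasurableSet.univ z s
  simp only [Set.inter_univ] at h2
  have heq : closeMisfit A δ q η s z = fun ω => if min (Metric.infEDist z (η ω)) s < s then
      misfitWeight A δ q (z, min (Metric.infEDist z (η ω ∩ A)) s,
        min (Metric.infEDist z (η ω)) s) else 0 := by
    funext ω
    by_cases h : Metric.infEDist z (η ω) < s
    · have h3 : min (Metric.infEDist z (η ω ∩ A)) s ≤ Metric.infEDist z (η ω) ↔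
          Metric.infEDist z (η ω ∩ A) ≤ Metric.infEDist z (η ω) := by
        rw [min_le_iff, or_iff_left h.not_ge]
      simp only [closeMisfit, localMisfit, misfitWeight, Set.indicator, min_eq_left h.le, h,
        if_true]
      split_ifs with a b b <;> 
        simp only [Set.mem_ofPred_eq, min_eq_left h.le, h3] at a b <;> tauto
    · simp [closeMisfit, h, not_lt.1 h]
  rw [heq]
  exact Measurable.ite (measurableSet_lt h2 measurable_const)
    ((measurable_misfitWeight hA δ q).comp (measurable_const.prodMk (h1.prodMk h2)))
    measurable_const

/-- If `z` reaches no `w i`, then `R` is below half of every distance and nothing is lost by the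
restriction; otherwise some term of the sum is the whole misfit. -/
theorem localMisfit_le_close_add (A : Set E) (δ : ℝ≥0) (q : ℕ) (η : Ω → Set E) {k : ℕ} (z : E)
    (w : Fin (k + 1) → E) (ω : Ω) :
    localMisfit A δ q η z ω ≤ closeMisfit A δ q η ((⨅ i, edist z (w i)) / 2) z ω
      + ∑ i, localMisfit A δ q η z ω * reach η z (w i) ω := by
  by_cases h : ∃ i, edist z (w i) ≤ 2 * Metric.infEDist z (η ω)
  · obtain ⟨i, hi⟩ := h
    refine le_trans ?_ le_add_self
    refine le_trans ?_ (Finset.single_le_sum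
      (f := fun i => localMisfit A δ q η z ω * reach η z (w i) ω) (fun _ _ => zero_le)
      (Finset.mem_univ i))
    simp [reach, hi]
  · push Not at h
    obtain ⟨i, hi⟩ := exists_eq_ciInf_of_finite (f := fun i => edist z (w i))
    have h1 : Metric.infEDist z (η ω) < (⨅ i, edist z (w i)) / 2 := by
      rw [← hi, ENNReal.lt_div_iff_mul_lt (by simp) (by simp), mul_comm]
      exact h i
    rw [closeMisfit, if_pos h1]
    exact le_self_add

theorem prod_localMisfit_le_close_add (A : Set E) (δ : ℝ≥0) (q : ℕ) (η : Ω → Set E) {k : ℕ}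
    (z : E) (w : Fin k → E) (ω : Ω) :
    ∏ i, localMisfit A δ q η (w i) ω ≤ ∏ i, closeMisfit A δ q η (edist z (w i) / 2) (w i) ω
      + ∑ i, (∏ j, localMisfit A δ q η (w j) ω) * reach η (w i) z ω := by
  by_cases h : ∃ i, edist (w i) z ≤ 2 * Metric.infEDist (w i) (η ω)
  · obtain ⟨i, hi⟩ := h
    refine le_trans ?_ le_add_self
    refine le_trans ?_ (Finset.single_le_sum
      (f := fun i => (∏ j, localMisfit A δ q η (w j) ω) * reach η (w i) z ω)
      (fun _ _ => zero_le) (Finset.mem_univ i))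
    simp [reach, hi]
  · push Not at h
    refine le_trans (le_of_eq (Finset.prod_congr rfl fun i _ => ?_)) le_self_add
    have h1 : Metric.infEDist (w i) (η ω) < edist z (w i) / 2 := by
      rw [ENNReal.lt_div_iff_mul_lt (by simp) (by simp), mul_comm, edist_comm]
      exact h i
    rw [closeMisfit, if_pos h1]

/-- The constant in the bound of the volume of points reached from a given point. -/
noncomputable def reachConst (d : ℕ) : ℝ≥0∞ :=
  2 ^ d * volume (Metric.ball (0 : EuclideanSpace ℝ (Fin d)) 1)

theorem reachConst_ne_top (d : ℕ) : reachConst d ≠ ∞ :=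
  ENNReal.mul_ne_top (by simp) measure_ball_lt_top.ne

/-- The points reached from `z` fill the closed ball of radius `2R`, and `R ≤ δ (1 + R/δ)`. -/
theorem lintegral_reach_le (hd : 1 ≤ d) {δ : ℝ≥0} (hδ : 0 < δ) (η : Ω → Set E) (z : E) (ω : Ω) :
    ∫⁻ u, reach η z u ω ≤
      reachConst d * (δ : ℝ≥0∞) ^ d * (1 + Metric.infEDist z (η ω) / δ) ^ d := by
  set R := Metric.infEDist z (η ω) with hR
  have hδ0 : (δ : ℝ≥0∞) ≠ 0 := by exact_mod_cast hδ.ne'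
  have hd0 : d ≠ 0 := by omega
  have hκ : volume (Metric.ball (0 : E) 1) ≠ 0 := (Metric.measure_ball_pos _ _ one_pos).ne'
  -- With no nucleus the right side is infinite, as `d ≥ 1`.
  rcases eq_or_ne R ∞ with hRt | hRt
  · rw [hRt, ENNReal.top_div_of_ne_top ENNReal.coe_ne_top, add_top, ENNReal.top_pow hd0,
      ENNReal.mul_top]
    · exact le_top
    · exact mul_ne_zero (mul_ne_zero (by simp) hκ) (pow_ne_zero _ hδ0)
  · lift R to ℝ≥0 using hRt with r
    have h1 : ∀ u, reach η z u ω
        = Set.indicator (Metric.closedBall z (2 * r)) (1 : E → ℝ≥0∞) u := fun u => by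
      simp only [reach, ← hR, Set.indicator, Metric.mem_closedBall, Pi.one_apply]
      refine if_congr ?_ rfl rfl
      rw [dist_comm, ← edist_le_ofReal (by positivity), ENNReal.ofReal_mul (by simp)]
      simp
    simp_rw [h1]
    rw [lintegral_indicator_one Metric.isClosed_closedBall.measurableSet,
      Measure.addHaar_closedBall _ _ (by positivity), finrank_euclideanSpace_fin,
      ENNReal.ofReal_pow (by positivity), ENNReal.ofReal_mul (by simp),
      ENNReal.ofReal_coe_nnreal, ENNReal.ofReal_ofNat, mul_pow, reachConst]
    have h2 : (r : ℝ≥0∞) ^ d ≤ (δ : ℝ≥0∞) ^ d * (1 + r / δ) ^ d := by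
      rw [← mul_pow]
      gcongr
      calc (r : ℝ≥0∞) = δ * (r / δ) := (ENNReal.mul_div_cancel hδ0 ENNReal.coe_ne_top).symm
        _ ≤ _ := by gcongr; exact le_add_self
    calc _ ≤ 2 ^ d * ((δ : ℝ≥0∞) ^ d * (1 + r / δ) ^ d) * volume (Metric.ball (0 : E) 1) := by
          gcongr
      _ = _ := by ring

/-- If `z` reaches `u`, the triangle inequality gives `R(u) ≤ 2 R(z) + R(z)`, so the weight at `u`
is at most `3^q` times that at `z`. -/
theorem localMisfit_mul_reach_le (A : Set E) (δ : ℝ≥0) (q : ℕ) (η : Ω → Set E) (z u : E) (ω : Ω) :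
    localMisfit A δ q η u ω * reach η z u ω ≤
      3 ^ q * (1 + Metric.infEDist z (η ω) / δ) ^ q * reach η z u ω := by
  unfold reach
  split_ifs with h
  · simp only [mul_one]
    refine (localMisfit_le_weight A δ q η u ω).trans ?_
    rw [← mul_pow]
    refine pow_le_pow_left' ?_ q
    have h1 : Metric.infEDist u (η ω) ≤ 3 * Metric.infEDist z (η ω) := by
      calc _ ≤ edist u z + Metric.infEDist z (η ω) := Metric.infEDist_le_edist_add_infEDist
        _ ≤ 2 * Metric.infEDist z (η ω) + Metric.infEDist z (η ω) := by
          rw [edist_comm]; gcongr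
        _ = _ := by ring
    calc 1 + Metric.infEDist u (η ω) / δ ≤ 3 + 3 * Metric.infEDist z (η ω) / δ := by
          gcongr; norm_num
      _ = _ := by rw [mul_add, mul_one, mul_div_assoc]
  · simp

/-- The exponent `2q + d` collects `q` from `z`, `q` from the comparison of `u` with `z`, and `d`
from the reached volume. -/
theorem lintegral_localMisfit_mul_reach_le (hd : 1 ≤ d) (A : Set E) {δ : ℝ≥0} (hδ : 0 < δ) (q : ℕ)
    (η : Ω → Set E) (z : E) (ω : Ω) :
    localMisfit A δ q η z ω * ∫⁻ u, localMisfit A δ q η u ω * reach η z u ω ≤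
      3 ^ q * reachConst d * (δ : ℝ≥0∞) ^ d * localMisfit A δ (2 * q + d) η z ω := by
  have hm : Measurable fun u => reach η z u ω :=
    Measurable.ite (measurableSet_le (by fun_prop) measurable_const) measurable_const
      measurable_const
  calc _ ≤ localMisfit A δ q η z ω *
        (3 ^ q * (1 + Metric.infEDist z (η ω) / δ) ^ q *
          (reachConst d * (δ : ℝ≥0∞) ^ d * (1 + Metric.infEDist z (η ω) / δ) ^ d)) := by
        gcongr
        refine (lintegral_mono fun u => localMisfit_mul_reach_le A δ q η z u ω).trans ?_
        rw [lintegral_const_mul _ hm]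
        exact mul_le_mul_right (lintegral_reach_le hd hδ η z ω) _
    _ = 3 ^ q * reachConst d * (δ : ℝ≥0∞) ^ d *
        (localMisfit A δ q η z ω * (1 + Metric.infEDist z (η ω) / δ) ^ (q + d)) := by
        rw [pow_add]; ring
    _ = _ := by rw [localMisfit_mul_weight]; congr 2; ring

variable [MeasurableSpace Ω] {P : Measure Ω} {lam : ℝ}
  {η : Ω → Set (EuclideanSpace ℝ (Fin d))} {A : Set (EuclideanSpace ℝ (Fin d))} {δ : ℝ≥0}

namespace IsHomogeneousPoissonProcess

theorem measurable_localMisfit_comp (hη : IsHomogeneousPoissonProcess P lam η)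
    (hA : MeasurableSet A) (δ : ℝ≥0) (q : ℕ) {Y : Type*} [MeasurableSpace Y] {a : Y → E}
    {b : Y → Ω} (ha : Measurable a) (hb : Measurable b) :
    Measurable fun y => localMisfit A δ q η (a y) (b y) :=
  (hη.measurable_localMisfit hA δ q).comp (ha.prodMk hb)

theorem measurable_reach_comp (hη : IsHomogeneousPoissonProcess P lam η) {Y : Type*}
    [MeasurableSpace Y] {a c : Y → E} {b : Y → Ω} (ha : Measurable a) (hc : Measurable c)
    (hb : Measurable b) : Measurable fun y => reach η (a y) (c y) (b y) :=
  Measurable.ite (measurableSet_le (ha.edist hc)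
    ((hη.measurable_infEDist_univ.comp (ha.prodMk hb)).const_mul 2)) measurable_const
    measurable_const

/-- The misfit seen close to `z` is independent of the misfits seen close to the other points. -/
theorem lintegral_close_mul [IsProbabilityMeasure P] (hη : IsHomogeneousPoissonProcess P lam η)
    (hA : MeasurableSet A) (δ : ℝ≥0) (q : ℕ) {k : ℕ} (z : E) (w : Fin (k + 1) → E) :
    ∫⁻ ω, closeMisfit A δ q η ((⨅ i, edist z (w i)) / 2) z ω *
        ∏ i, closeMisfit A δ q η (edist z (w i) / 2) (w i) ω ∂P
      = (∫⁻ ω, closeMisfit A δ q η ((⨅ i, edist z (w i)) / 2) z ω ∂P) *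
        ∫⁻ ω, ∏ i, closeMisfit A δ q η (edist z (w i) / 2) (w i) ω ∂P := by
  -- The ball of radius `ρ` about `z` misses each ball about `w i` of radius half of the distance to
  -- `z`. The `w i` may be close to each other: only their separation from `z` matters.
  set ρ := (⨅ i, edist z (w i)) / 2 with hρ
  refine lintegral_mul_eq_lintegral_mul_lintegral_of_independent_measurableSpace
    (hη.localSigma_le (Metric.eball z ρ)) (hη.localSigma_le (Metric.eball z ρ)ᶜ)
    (hη.indep_localSigma disjoint_compl_right)
    (measurable_localSigma_closeMisfit hA δ q η ρ z) ?_
  let _ : MeasurableSpace Ω := localSigma η (Metric.eball z ρ)ᶜ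
  refine Finset.measurable_prod _ fun i _ => ?_
  refine (measurable_localSigma_closeMisfit hA δ q η (edist z (w i) / 2) (w i)).mono
    (localSigma_mono η fun x hx hxz => ?_) le_rfl
  rw [Metric.mem_eball] at hx hxz
  have h1 : ρ ≤ edist z (w i) / 2 := by rw [hρ]; gcongr; exact iInf_le _ i
  have h2 : edist z (w i) < edist z (w i) / 2 + edist z (w i) / 2 :=
    calc edist z (w i) ≤ edist z x + edist x (w i) := edist_triangle _ _ _
      _ < _ := ENNReal.add_lt_add (by rw [edist_comm]; exact hxz.trans_le h1) hx
  rw [ENNReal.add_halves] at h2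
  exact lt_irrefl _ h2

end IsHomogeneousPoissonProcess

end Decoupling

/-! ### Exchange of integrals -/

section Fubini

variable {X Y Z : Type*} [MeasurableSpace X] [MeasurableSpace Y] [MeasurableSpace Z]
  {μ : Measure X} {ν : Measure Y} {ρ : Measure Z} [SFinite ν] [SFinite ρ]

theorem measurable_lintegral_last {F : X → Y → Z → ℝ≥0∞}
    (hF : Measurable fun p : X × Y × Z => F p.1 p.2.1 p.2.2) :
    Measurable fun p : X × Y => ∫⁻ c, F p.1 p.2 c ∂ρ :=
  Measurable.lintegral_prod_right' (f := fun p : (X × Y) × Z => F p.1.1 p.1.2 p.2)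
    (hF.comp (f := fun p : (X × Y) × Z => (p.1.1, p.1.2, p.2)) (by fun_prop))

theorem lintegral_lintegral_lintegral_rotate [SFinite μ] {F : X → Y → Z → ℝ≥0∞}
    (hF : Measurable fun p : X × Y × Z => F p.1 p.2.1 p.2.2) :
    ∫⁻ a, ∫⁻ b, ∫⁻ c, F a b c ∂ρ ∂ν ∂μ = ∫⁻ c, ∫⁻ a, ∫⁻ b, F a b c ∂ν ∂μ ∂ρ := by
  have h1 : ∀ a, ∫⁻ b, ∫⁻ c, F a b c ∂ρ ∂ν = ∫⁻ c, ∫⁻ b, F a b c ∂ν ∂ρ := fun a =>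
    lintegral_lintegral_swap (hF.comp measurable_prodMk_left).aemeasurable
  simp_rw [h1]
  exact lintegral_lintegral_swap (Measurable.lintegral_prod_right'
    (f := fun p : (X × Z) × Y => F p.1.1 p.2 p.1.2)
    (hF.comp (f := fun p : (X × Z) × Y => (p.1.1, p.2, p.1.2)) (by fun_prop))).aemeasurable

theorem lintegral_lintegral_add {e c : X → Y → ℝ≥0∞} (he : Measurable fun p : X × Y => e p.1 p.2) :
    ∫⁻ a, ∫⁻ b, (e a b + c a b) ∂ν ∂μ = ∫⁻ a, ∫⁻ b, e a b ∂ν ∂μ + ∫⁻ a, ∫⁻ b, c a b ∂ν ∂μ := by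
  have h1 : ∀ a, ∫⁻ b, (e a b + c a b) ∂ν = ∫⁻ b, e a b ∂ν + ∫⁻ b, c a b ∂ν := fun a =>
    lintegral_add_left (he.comp measurable_prodMk_left) _
  simp_rw [h1]
  rw [lintegral_add_left he.lintegral_prod_right']

theorem lintegral_lintegral_add_sum {ι : Type*} [Fintype ι] {e : X → Y → ℝ≥0∞}
    {c : ι → X → Y → ℝ≥0∞} (he : Measurable fun p : X × Y => e p.1 p.2)
    (hc : ∀ i, Measurable fun p : X × Y => c i p.1 p.2) :
    ∫⁻ a, ∫⁻ b, (e a b + ∑ i, c i a b) ∂ν ∂μ =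
      ∫⁻ a, ∫⁻ b, e a b ∂ν ∂μ + ∑ i, ∫⁻ a, ∫⁻ b, c i a b ∂ν ∂μ := by
  have h1 : ∀ a, ∫⁻ b, (e a b + ∑ i, c i a b) ∂ν = ∫⁻ b, e a b ∂ν + ∑ i, ∫⁻ b, c i a b ∂ν :=
    fun a => by
      have he' : Measurable (e a) := he.comp measurable_prodMk_left
      have hc' : ∀ i, Measurable (c i a) := fun i => (hc i).comp measurable_prodMk_left
      rw [lintegral_add_left he', lintegral_finsetSum _ fun i _ => hc' i]
  simp_rw [h1]
  rw [lintegral_add_left he.lintegral_prod_right',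
    lintegral_finsetSum _ fun i _ => (hc i).lintegral_prod_right']

theorem lintegral_prod_mul_kernel {X : Type*} [MeasureSpace X] [SigmaFinite (volume : Measure X)]
    {k : ℕ} {f : X → ℝ≥0∞} {g : X → X → ℝ≥0∞} (hf : Measurable f)
    (hg : Measurable fun p : X × X => g p.1 p.2) (i : Fin (k + 1)) :
    ∫⁻ z, ∫⁻ w : Fin (k + 1) → X, (∏ j, f (w j)) * g (w i) z
      = (∫⁻ x, f x) ^ k * ∫⁻ u, f u * ∫⁻ z, g u z := by
  have hg1 : ∀ u, Measurable (g u) := fun u => hg.comp measurable_prodMk_left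
  have hg2 : ∀ z, Measurable fun u => g u z := fun z => hg.comp measurable_prodMk_right
  have hF : Measurable fun p : X × X => f p.2 * g p.2 p.1 :=
    (hf.comp measurable_snd).mul (hg.comp measurable_swap)
  simp_rw [fun z => lintegral_fin_prod_mul hf (hg2 z) i]
  rw [lintegral_const_mul _ hF.lintegral_prod_right',
    lintegral_lintegral_swap (f := fun z u => f u * g u z) hF.aemeasurable]
  exact congrArg _ (lintegral_congr fun u => lintegral_const_mul (f u) (hg1 u))

/-- Exchanging `z` and `w i` shows that both kernel terms contribute equally; the other `k`
coordinates integrate freely. -/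
theorem lintegral_mul_prod_mul_kernel {X : Type*} [MeasureSpace X]
    [SigmaFinite (volume : Measure X)] {k : ℕ} {f : X → ℝ≥0∞} {g : X → X → ℝ≥0∞}
    (hf : Measurable f) (hg : Measurable fun p : X × X => g p.1 p.2) (i : Fin (k + 1)) :
    ∫⁻ z, ∫⁻ w : Fin (k + 1) → X, f z * ((∏ j, f (w j)) * (g z (w i) + g (w i) z))
      = 2 * (∫⁻ x, f x) ^ k * ∫⁻ z, f z * ∫⁻ u, f u * g z u := by
  have hg1 : ∀ u, Measurable (g u) := fun u => hg.comp measurable_prodMk_left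
  have hg2 : ∀ z, Measurable fun u => g u z := fun z => hg.comp measurable_prodMk_right
  have hP : Measurable fun w : Fin (k + 1) → X => ∏ j, f (w j) :=
    Finset.measurable_prod _ fun j _ => hf.comp (measurable_pi_apply j)
  have hF : Measurable fun p : X × X => f p.2 * g p.1 p.2 := (hf.comp measurable_snd).mul hg
  have hm1 : Measurable fun z => f z * ∫⁻ u, f u * g z u := hf.fun_mul hF.lintegral_prod_right'
  have hF2 : Measurable fun p : X × X => f p.1 * (f p.2 * g p.2 p.1) :=
    (hf.comp measurable_fst).mul ((hf.comp measurable_snd).mul (hg.comp measurable_swap))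
  have hinner : ∀ z, ∫⁻ w : Fin (k + 1) → X, f z * ((∏ j, f (w j)) * (g z (w i) + g (w i) z))
      = (∫⁻ x, f x) ^ k * (f z * ∫⁻ u, f u * g z u)
        + (∫⁻ x, f x) ^ k * ∫⁻ u, f z * (f u * g u z) := fun z => by
    have hgz : Measurable fun u => g z u + g u z := (hg1 z).fun_add (hg2 z)
    have hgw : Measurable fun w : Fin (k + 1) → X => g z (w i) + g (w i) z :=
      hgz.comp (measurable_pi_apply i)
    rw [lintegral_const_mul _ (hP.fun_mul hgw), lintegral_fin_prod_mul hf hgz i]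
    simp_rw [mul_add]
    rw [lintegral_add_left (hf.fun_mul (hg1 z)), lintegral_const_mul _ (hf.fun_mul (hg2 z))]
    ring
  have hswap : ∫⁻ z, ∫⁻ u, f z * (f u * g u z) = ∫⁻ z, f z * ∫⁻ u, f u * g z u := by
    rw [lintegral_lintegral_swap hF2.aemeasurable]
    refine lintegral_congr fun u => ?_
    rw [← lintegral_const_mul _ (hf.fun_mul (hg1 u))]
    exact lintegral_congr fun z => by ring
  simp_rw [hinner]
  rw [lintegral_add_left (hm1.const_mul _), lintegral_const_mul _ hm1,
    lintegral_const_mul _ hF2.lintegral_prod_right', hswap]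
  ring

end Fubini

/-! ### Near factorisation of moments -/

section Covariance

variable {d : ℕ} {Ω : Type*} [MeasurableSpace Ω] {P : Measure Ω} {lam : ℝ}
  {η : Ω → Set (EuclideanSpace ℝ (Fin d))} {A : Set (EuclideanSpace ℝ (Fin d))} {δ : ℝ≥0}

local notation "E" => EuclideanSpace ℝ (Fin d)

namespace IsHomogeneousPoissonProcess

theorem measurable_prod_localMisfit_comp (hη : IsHomogeneousPoissonProcess P lam η)
    (hA : MeasurableSet A) (δ : ℝ≥0) (q : ℕ) {Y : Type*} [MeasurableSpace Y] {k : ℕ}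
    {a : Y → Fin k → E} {b : Y → Ω} (ha : Measurable a) (hb : Measurable b) :
    Measurable fun y => ∏ j, localMisfit A δ q η (a y j) (b y) :=
  Finset.measurable_prod _ fun j _ => hη.measurable_localMisfit_comp hA δ q
    ((measurable_pi_apply j).comp ha) hb

theorem measurable_closeMisfit (hη : IsHomogeneousPoissonProcess P lam η)
    (hA : MeasurableSet A) (δ : ℝ≥0) (q : ℕ) (s : ℝ≥0∞) (z : E) :
    Measurable (closeMisfit A δ q η s z) :=
  (measurable_localSigma_closeMisfit hA δ q η s z).mono (hη.localSigma_le _) le_rfl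

/-- Decorrelation at fixed points, from above. -/
theorem lintegral_mul_prod_le [IsProbabilityMeasure P] (hη : IsHomogeneousPoissonProcess P lam η)
    (hA : MeasurableSet A) (δ : ℝ≥0) (q : ℕ) {k : ℕ} (z : E) (w : Fin (k + 1) → E) :
    ∫⁻ ω, localMisfit A δ q η z ω * ∏ j, localMisfit A δ q η (w j) ω ∂P ≤
      (∫⁻ ω, localMisfit A δ q η z ω ∂P) * (∫⁻ ω, ∏ j, localMisfit A δ q η (w j) ω ∂P)
      + ∑ i, ∫⁻ ω, localMisfit A δ q η z ω * ((∏ j, localMisfit A δ q η (w j) ω) *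
          (reach η z (w i) ω + reach η (w i) z ω)) ∂P := by
  have hX : Measurable fun ω => localMisfit A δ q η z ω :=
    hη.measurable_localMisfit_comp hA δ q measurable_const measurable_id
  have hY : Measurable fun ω => ∏ j, localMisfit A δ q η (w j) ω :=
    hη.measurable_prod_localMisfit_comp hA δ q measurable_const measurable_id
  have hN : ∀ u v : E, Measurable fun ω => reach η u v ω := fun u v =>
    hη.measurable_reach_comp measurable_const measurable_const measurable_id
  have hf := hη.measurable_closeMisfit hA δ q ((⨅ i, edist z (w i)) / 2) z
  have hg : Measurable fun ω => ∏ i, closeMisfit A δ q η (edist z (w i) / 2) (w i) ω :=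
    Finset.measurable_prod _ fun i _ => hη.measurable_closeMisfit hA δ q _ (w i)
  have hpt : ∀ ω, localMisfit A δ q η z ω * ∏ j, localMisfit A δ q η (w j) ω ≤
      closeMisfit A δ q η ((⨅ i, edist z (w i)) / 2) z ω *
        ∏ i, closeMisfit A δ q η (edist z (w i) / 2) (w i) ω
      + ∑ i, localMisfit A δ q η z ω * ((∏ j, localMisfit A δ q η (w j) ω) *
          (reach η z (w i) ω + reach η (w i) z ω)) := fun ω => by
    set X := localMisfit A δ q η z ω
    set Y := ∏ j, localMisfit A δ q η (w j) ω
    set f := closeMisfit A δ q η ((⨅ i, edist z (w i)) / 2) z ω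
    set g := ∏ i, closeMisfit A δ q η (edist z (w i) / 2) (w i) ω
    -- Localise at `z` first, keeping `Y`; then localise `Y` in the product `f * Y`, with `f ≤ X` in
    -- the new error terms.
    calc X * Y ≤ (f + ∑ i, X * reach η z (w i) ω) * Y := by
          gcongr; exact localMisfit_le_close_add A δ q η z w ω
      _ = f * Y + ∑ i, X * (Y * reach η z (w i) ω) := by
          rw [add_mul, Finset.sum_mul]; congr 1
          exact Finset.sum_congr rfl fun i _ => by ring
      _ ≤ f * (g + ∑ i, Y * reach η (w i) z ω) + ∑ i, X * (Y * reach η z (w i) ω) := by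
          gcongr; exact prod_localMisfit_le_close_add A δ q η z w ω
      _ ≤ f * g + X * ∑ i, Y * reach η (w i) z ω + ∑ i, X * (Y * reach η z (w i) ω) := by
          rw [mul_add]; gcongr; exact closeMisfit_le A δ q η _ z ω
      _ = _ := by
          rw [Finset.mul_sum, add_assoc, ← Finset.sum_add_distrib]
          congr 1
          exact Finset.sum_congr rfl fun i _ => by ring
  refine (lintegral_mono hpt).trans ?_
  rw [lintegral_add_left (hf.fun_mul hg), lintegral_finsetSum _ fun i _ =>
    hX.fun_mul (hY.fun_mul ((hN z (w i)).fun_add (hN (w i) z))), hη.lintegral_close_mul hA δ q z w]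
  gcongr with ω ω i _
  · exact closeMisfit_le A δ q η _ z ω
  · exact closeMisfit_le A δ q η _ (w i) ω

/-- Decorrelation at fixed points, from below, for weights at most `1`. -/
theorem mul_lintegral_prod_le [IsProbabilityMeasure P] (hη : IsHomogeneousPoissonProcess P lam η)
    (hA : MeasurableSet A) (δ : ℝ≥0) {k : ℕ} (z : E) (w : Fin (k + 1) → E) :
    (∫⁻ ω, localMisfit A δ 0 η z ω ∂P) * (∫⁻ ω, ∏ j, localMisfit A δ 0 η (w j) ω ∂P) ≤
      ∫⁻ ω, localMisfit A δ 0 η z ω * ∏ j, localMisfit A δ 0 η (w j) ω ∂P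
      + ∑ i, ((∫⁻ ω, localMisfit A δ 0 η z ω * reach η z (w i) ω ∂P) *
            (∫⁻ ω, ∏ j, localMisfit A δ 0 η (w j) ω ∂P)
          + ∫⁻ ω, (∏ j, localMisfit A δ 0 η (w j) ω) * reach η (w i) z ω ∂P) := by
  have hX : Measurable fun ω => localMisfit A δ 0 η z ω :=
    hη.measurable_localMisfit_comp hA δ 0 measurable_const measurable_id
  have hY : Measurable fun ω => ∏ j, localMisfit A δ 0 η (w j) ω :=
    hη.measurable_prod_localMisfit_comp hA δ 0 measurable_const measurable_id
  have hN : ∀ u v : E, Measurable fun ω => reach η u v ω := fun u v =>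
    hη.measurable_reach_comp measurable_const measurable_const measurable_id
  have hf := hη.measurable_closeMisfit hA δ 0 ((⨅ i, edist z (w i)) / 2) z
  have hg : Measurable fun ω => ∏ i, closeMisfit A δ 0 η (edist z (w i) / 2) (w i) ω :=
    Finset.measurable_prod _ fun i _ => hη.measurable_closeMisfit hA δ 0 _ (w i)
  set EY := ∫⁻ ω, ∏ j, localMisfit A δ 0 η (w j) ω ∂P with hEY
  set Ef := ∫⁻ ω, closeMisfit A δ 0 η ((⨅ i, edist z (w i)) / 2) z ω ∂P with hEf
  set Eg := ∫⁻ ω, ∏ i, closeMisfit A δ 0 η (edist z (w i) / 2) (w i) ω ∂P with hEg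
  have h1 : ∫⁻ ω, localMisfit A δ 0 η z ω ∂P ≤
      Ef + ∑ i, ∫⁻ ω, localMisfit A δ 0 η z ω * reach η z (w i) ω ∂P := by
    rw [hEf, ← lintegral_finsetSum _ fun i _ => hX.fun_mul (hN z (w i)), ← lintegral_add_left hf]
    exact lintegral_mono fun ω => localMisfit_le_close_add A δ 0 η z w ω
  have h2 : EY ≤ Eg +
      ∑ i, ∫⁻ ω, (∏ j, localMisfit A δ 0 η (w j) ω) * reach η (w i) z ω ∂P := by
    rw [hEg, ← lintegral_finsetSum _ fun i _ => hY.fun_mul (hN (w i) z), ← lintegral_add_left hg]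
    exact lintegral_mono fun ω => prod_localMisfit_le_close_add A δ 0 η z w ω
  -- Exponent `0` matters here: the error from localising the product is multiplied by `Ef`, which
  -- can be dropped.
  have h3 : Ef ≤ 1 := by
    calc Ef ≤ ∫⁻ _, 1 ∂P := lintegral_mono fun ω =>
          (closeMisfit_le A δ 0 η _ z ω).trans (localMisfit_zero_le_one A δ η z ω)
      _ = 1 := by simp
  have h4 : Ef * Eg ≤ ∫⁻ ω, localMisfit A δ 0 η z ω * ∏ j, localMisfit A δ 0 η (w j) ω ∂P := by
    rw [hEf, hEg, ← hη.lintegral_close_mul hA δ 0 z w]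
    gcongr with ω i _
    · exact closeMisfit_le A δ 0 η _ z ω
    · exact closeMisfit_le A δ 0 η _ (w i) ω
  calc _ ≤ (Ef + ∑ i, ∫⁻ ω, localMisfit A δ 0 η z ω * reach η z (w i) ω ∂P) * EY := by gcongr
    _ = Ef * EY + ∑ i, (∫⁻ ω, localMisfit A δ 0 η z ω * reach η z (w i) ω ∂P) * EY := by
      rw [add_mul, Finset.sum_mul]
    _ ≤ Ef * (Eg + ∑ i, ∫⁻ ω, (∏ j, localMisfit A δ 0 η (w j) ω) * reach η (w i) z ω ∂P)
        + ∑ i, (∫⁻ ω, localMisfit A δ 0 η z ω * reach η z (w i) ω ∂P) * EY := by gcongr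
    _ ≤ (Ef * Eg + 1 * ∑ i, ∫⁻ ω, (∏ j, localMisfit A δ 0 η (w j) ω) * reach η (w i) z ω ∂P)
        + ∑ i, (∫⁻ ω, localMisfit A δ 0 η z ω * reach η z (w i) ω ∂P) * EY := by
      rw [mul_add]; gcongr
    _ ≤ _ := by
      rw [one_mul, add_assoc, add_comm (∑ i, ∫⁻ ω, (∏ j, localMisfit A δ 0 η (w j) ω) * _ ∂P),
        ← Finset.sum_add_distrib]
      gcongr

theorem lintegral_localMisfit (hη : IsHomogeneousPoissonProcess P lam η) [SFinite P]
    (hA : MeasurableSet A) (δ : ℝ≥0) (q : ℕ) :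
    ∫⁻ z, ∫⁻ ω, localMisfit A δ q η z ω ∂P = ∫⁻ ω, totalMisfit A δ q η ω ∂P :=
  lintegral_lintegral_swap (hη.measurable_localMisfit hA δ q).aemeasurable

theorem lintegral_prod_localMisfit (hη : IsHomogeneousPoissonProcess P lam η) [SFinite P]
    (hA : MeasurableSet A) (δ : ℝ≥0) (q k : ℕ) :
    ∫⁻ w : Fin k → E, ∫⁻ ω, ∏ j, localMisfit A δ q η (w j) ω ∂P
      = ∫⁻ ω, totalMisfit A δ q η ω ^ k ∂P := by
  rw [lintegral_lintegral_swap
    (hη.measurable_prod_localMisfit_comp hA δ q measurable_fst measurable_snd).aemeasurable]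
  exact lintegral_congr fun ω => lintegral_fin_prod_pow
    (hη.measurable_localMisfit_comp hA δ q measurable_id measurable_const)

theorem lintegral_mul_prod_localMisfit (hη : IsHomogeneousPoissonProcess P lam η) [SFinite P]
    (hA : MeasurableSet A) (δ : ℝ≥0) (q k : ℕ) :
    ∫⁻ z, ∫⁻ w : Fin k → E, ∫⁻ ω, localMisfit A δ q η z ω *
        ∏ j, localMisfit A δ q η (w j) ω ∂P = ∫⁻ ω, totalMisfit A δ q η ω ^ (k + 1) ∂P := by
  rw [lintegral_lintegral_lintegral_rotate ((hη.measurable_localMisfit_comp hA δ q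
      (by fun_prop) (by fun_prop)).mul (hη.measurable_prod_localMisfit_comp hA δ q
      (by fun_prop) (by fun_prop)))]
  refine lintegral_congr fun ω => ?_
  have hX := hη.measurable_localMisfit_comp hA δ q measurable_id (measurable_const (a := ω))
  have hY := hη.measurable_prod_localMisfit_comp hA δ q (k := k) measurable_id
    (measurable_const (a := ω))
  simp only [id] at hX hY
  simp_rw [lintegral_const_mul _ hY, lintegral_fin_prod_pow hX, lintegral_mul_const _ hX]
  rw [pow_succ', totalMisfit]

/-- Only `w i` interacts with `z`, at the cost of the reached volume; every other point gives a free
factor. The `2` counts the two directions of `reach`. -/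
theorem lintegral_prod_reach_le (hη : IsHomogeneousPoissonProcess P lam η)
    (hA : MeasurableSet A) (hd : 1 ≤ d) (hδ : 0 < δ) (q k : ℕ) (i : Fin (k + 1)) (ω : Ω) :
    ∫⁻ z, ∫⁻ w : Fin (k + 1) → E, localMisfit A δ q η z ω * ((∏ j, localMisfit A δ q η (w j) ω) *
        (reach η z (w i) ω + reach η (w i) z ω)) ≤
      2 * 3 ^ q * reachConst d * (δ : ℝ≥0∞) ^ d * totalMisfit A δ (2 * q + d) η ω ^ (k + 1) := by
  have hX : Measurable fun z => localMisfit A δ q η z ω :=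
    hη.measurable_localMisfit_comp hA δ q measurable_id measurable_const
  have hX' : Measurable fun z => localMisfit A δ (2 * q + d) η z ω :=
    hη.measurable_localMisfit_comp hA δ _ measurable_id measurable_const
  have hN : Measurable fun p : E × E => reach η p.1 p.2 ω :=
    hη.measurable_reach_comp measurable_fst measurable_snd measurable_const
  have hB : ∫⁻ z, localMisfit A δ q η z ω * ∫⁻ u, localMisfit A δ q η u ω * reach η z u ω ≤
      3 ^ q * reachConst d * (δ : ℝ≥0∞) ^ d * totalMisfit A δ (2 * q + d) η ω := by
    rw [totalMisfit, ← lintegral_const_mul _ hX']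
    exact lintegral_mono fun z => lintegral_localMisfit_mul_reach_le hd A hδ q η z ω
  rw [lintegral_mul_prod_mul_kernel (g := fun z u => reach η z u ω) hX hN i]
  calc _ ≤ 2 * totalMisfit A δ (2 * q + d) η ω ^ k *
        (3 ^ q * reachConst d * (δ : ℝ≥0∞) ^ d * totalMisfit A δ (2 * q + d) η ω) := by
        refine mul_le_mul' (mul_le_mul_right (pow_le_pow_left' ?_ k) 2) hB
        exact totalMisfit_mono A δ (by omega) η ω
    _ = _ := by ring

/-- Raising the power by one decorrelates, up to a term of smaller order. -/
theorem lintegral_totalMisfit_pow_le [IsProbabilityMeasure P]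
    (hη : IsHomogeneousPoissonProcess P lam η)
    (hA : MeasurableSet A) (hd : 1 ≤ d) (hδ : 0 < δ) (q k : ℕ) :
    ∫⁻ ω, totalMisfit A δ q η ω ^ (k + 2) ∂P ≤
      (∫⁻ ω, totalMisfit A δ q η ω ∂P) * (∫⁻ ω, totalMisfit A δ q η ω ^ (k + 1) ∂P)
      + (k + 1) * (2 * 3 ^ q * reachConst d * (δ : ℝ≥0∞) ^ d *
        ∫⁻ ω, totalMisfit A δ (2 * q + d) η ω ^ (k + 1) ∂P) := by
  have hX : Measurable fun p : E × (Fin (k + 1) → E) × Ω => localMisfit A δ q η p.1 p.2.2 :=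
    hη.measurable_localMisfit_comp hA δ q (by fun_prop) (by fun_prop)
  have hY : Measurable fun p : E × (Fin (k + 1) → E) × Ω =>
      ∏ j, localMisfit A δ q η (p.2.1 j) p.2.2 :=
    hη.measurable_prod_localMisfit_comp hA δ q (by fun_prop) (by fun_prop)
  have hF : ∀ i, Measurable fun p : E × (Fin (k + 1) → E) × Ω => localMisfit A δ q η p.1 p.2.2 *
      ((∏ j, localMisfit A δ q η (p.2.1 j) p.2.2) *
          (reach η p.1 (p.2.1 i) p.2.2 + reach η (p.2.1 i) p.1 p.2.2)) := fun i =>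
    hX.mul (hY.mul ((hη.measurable_reach_comp (by fun_prop) (by fun_prop) (by fun_prop)).add
      (hη.measurable_reach_comp (by fun_prop) (by fun_prop) (by fun_prop))))
  have ha : Measurable fun z => ∫⁻ ω, localMisfit A δ q η z ω ∂P :=
    (hη.measurable_localMisfit hA δ q).lintegral_prod_right'
  have hb : Measurable fun w : Fin (k + 1) → E => ∫⁻ ω, ∏ j, localMisfit A δ q η (w j) ω ∂P :=
    (hη.measurable_prod_localMisfit_comp hA δ q measurable_fst measurable_snd).lintegral_prod_right'
  have hc : ∀ i, Measurable fun p : E × (Fin (k + 1) → E) =>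
      ∫⁻ ω, localMisfit A δ q η p.1 ω * ((∏ j, localMisfit A δ q η (p.2 j) ω) *
        (reach η p.1 (p.2 i) ω + reach η (p.2 i) p.1 ω)) ∂P := fun i =>
    measurable_lintegral_last (ρ := P) (F := fun (z : E) (w : Fin (k + 1) → E) (ω : Ω) => localMisfit A δ q η z ω *
      ((∏ j, localMisfit A δ q η (w j) ω) * (reach η z (w i) ω + reach η (w i) z ω))) (hF i)
  rw [← hη.lintegral_mul_prod_localMisfit hA δ q (k + 1)]
  refine (lintegral_mono fun z => lintegral_mono fun w =>
    hη.lintegral_mul_prod_le hA δ q z w).trans ?_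
  rw [lintegral_lintegral_add_sum ((ha.comp measurable_fst).mul (hb.comp measurable_snd))
    hc]
  refine add_le_add (le_of_eq ?_) ?_
  · simp_rw [lintegral_const_mul _ hb, lintegral_mul_const _ ha]
    rw [hη.lintegral_localMisfit, hη.lintegral_prod_localMisfit] <;> exact hA
  · have hV := (hη.measurable_totalMisfit hA δ (2 * q + d)).pow_const (k + 1)
    calc _ ≤ ∑ _ : Fin (k + 1), 2 * 3 ^ q * reachConst d * (δ : ℝ≥0∞) ^ d *
          ∫⁻ ω, totalMisfit A δ (2 * q + d) η ω ^ (k + 1) ∂P := by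
          refine Finset.sum_le_sum fun i _ => ?_
          rw [lintegral_lintegral_lintegral_rotate (F := fun (z : E) (w : Fin (k + 1) → E) (ω : Ω) => localMisfit A δ q η z ω *
            ((∏ j, localMisfit A δ q η (w j) ω) * (reach η z (w i) ω + reach η (w i) z ω)))
            (hF i), ← lintegral_const_mul _ hV]
          exact lintegral_mono fun ω => hη.lintegral_prod_reach_le hA hd hδ q k i ω
      _ = _ := by
          rw [Finset.sum_const, Finset.card_univ, Fintype.card_fin, nsmul_eq_mul]
          push_cast
          rfl

theorem lintegral_localMisfit_mul_lintegral_reach_le (hη : IsHomogeneousPoissonProcess P lam η)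
    (hA : MeasurableSet A) (hd : 1 ≤ d) (hδ : 0 < δ) (ω : Ω) :
    ∫⁻ z, localMisfit A δ 0 η z ω * ∫⁻ u, reach η z u ω ≤
      reachConst d * (δ : ℝ≥0∞) ^ d * totalMisfit A δ d η ω := by
  have hX : Measurable fun z => localMisfit A δ d η z ω :=
    hη.measurable_localMisfit_comp hA δ d measurable_id measurable_const
  rw [totalMisfit, ← lintegral_const_mul _ hX]
  refine lintegral_mono fun z => ?_
  calc _ ≤ localMisfit A δ 0 η z ω *
        (reachConst d * (δ : ℝ≥0∞) ^ d * (1 + Metric.infEDist z (η ω) / δ) ^ d) := by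
        gcongr; exact lintegral_reach_le hd hδ η z ω
    _ = reachConst d * (δ : ℝ≥0∞) ^ d *
        (localMisfit A δ 0 η z ω * (1 + Metric.infEDist z (η ω) / δ) ^ d) := by ring
    _ = _ := by rw [localMisfit_mul_weight, zero_add]

theorem lintegral_prod_mul_reach_le (hη : IsHomogeneousPoissonProcess P lam η)
    (hA : MeasurableSet A) (hd : 1 ≤ d) (hδ : 0 < δ) {k : ℕ} (i : Fin (k + 1)) (ω : Ω) :
    ∫⁻ z, ∫⁻ w : Fin (k + 1) → E, (∏ j, localMisfit A δ 0 η (w j) ω) * reach η (w i) z ω ≤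
      reachConst d * (δ : ℝ≥0∞) ^ d * totalMisfit A δ d η ω ^ (k + 1) := by
  have hX : Measurable fun z => localMisfit A δ 0 η z ω :=
    hη.measurable_localMisfit_comp hA δ 0 measurable_id measurable_const
  have hN : Measurable fun p : E × E => reach η p.1 p.2 ω :=
    hη.measurable_reach_comp measurable_fst measurable_snd measurable_const
  rw [lintegral_prod_mul_kernel (g := fun z u => reach η z u ω) hX hN i]
  calc _ ≤ totalMisfit A δ d η ω ^ k *
        (reachConst d * (δ : ℝ≥0∞) ^ d * totalMisfit A δ d η ω) :=
        mul_le_mul' (pow_le_pow_left' (totalMisfit_mono A δ (Nat.zero_le d) η ω) k)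
          (hη.lintegral_localMisfit_mul_lintegral_reach_le hA hd hδ ω)
    _ = _ := by ring

/-- The misfit at `w i` is at most `1` and is dropped, so that `w i` carries only `g`; this lowers
the moment from `k + 1` to `k`. -/
theorem lintegral_mul_lintegral_prod_le (hη : IsHomogeneousPoissonProcess P lam η) [SFinite P]
    (hA : MeasurableSet A) (δ : ℝ≥0) {k : ℕ} (i : Fin (k + 1)) {g : E → ℝ≥0∞}
    (hg : Measurable g) :
    ∫⁻ w : Fin (k + 1) → E, g (w i) * (∫⁻ ω, ∏ j, localMisfit A δ 0 η (w j) ω ∂P) ≤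
      (∫⁻ u, g u) * ∫⁻ ω, totalMisfit A δ 0 η ω ^ k ∂P := by
  have hY : Measurable fun p : (Fin (k + 1) → E) × Ω => ∏ j, localMisfit A δ 0 η (p.1 j) p.2 :=
    hη.measurable_prod_localMisfit_comp hA δ 0 measurable_fst measurable_snd
  have hV := (hη.measurable_totalMisfit hA δ 0).pow_const k
  calc _ = ∫⁻ w : Fin (k + 1) → E, ∫⁻ ω, (∏ j, localMisfit A δ 0 η (w j) ω) * g (w i) ∂P := by
        refine lintegral_congr fun w => ?_
        have hYw : Measurable fun ω => ∏ j, localMisfit A δ 0 η (w j) ω :=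
          hY.comp measurable_prodMk_left
        rw [lintegral_mul_const _ hYw, mul_comm]
    _ = ∫⁻ ω, (∫⁻ w : Fin (k + 1) → E, (∏ j, localMisfit A δ 0 η (w j) ω) * g (w i)) ∂P :=
        lintegral_lintegral_swap (hY.mul
          (hg.comp ((measurable_pi_apply i).comp measurable_fst))).aemeasurable
    _ ≤ ∫⁻ ω, (∫⁻ u, g u) * totalMisfit A δ 0 η ω ^ k ∂P := by
        refine lintegral_mono fun ω => ?_
        have hX : Measurable fun z => localMisfit A δ 0 η z ω :=
          hη.measurable_localMisfit_comp hA δ 0 measurable_id measurable_const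
        rw [lintegral_fin_prod_mul hX hg i, mul_comm]
        gcongr with u
        · exact mul_le_of_le_one_left' (localMisfit_zero_le_one A δ η u ω)
        · exact le_rfl
    _ = _ := lintegral_const_mul _ hV

theorem lintegral_lintegral_reach_le [SFinite P] (hη : IsHomogeneousPoissonProcess P lam η)
    (hA : MeasurableSet A) (hd : 1 ≤ d) (hδ : 0 < δ) :
    ∫⁻ z, ∫⁻ u, ∫⁻ ω, localMisfit A δ 0 η z ω * reach η z u ω ∂P ≤
      reachConst d * (δ : ℝ≥0∞) ^ d * ∫⁻ ω, totalMisfit A δ d η ω ∂P := by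
  have hF : Measurable fun p : E × E × Ω => localMisfit A δ 0 η p.1 p.2.2 *
      reach η p.1 p.2.1 p.2.2 :=
    (hη.measurable_localMisfit_comp hA δ 0 (by fun_prop) (by fun_prop)).mul
      (hη.measurable_reach_comp (by fun_prop) (by fun_prop) (by fun_prop))
  rw [lintegral_lintegral_lintegral_rotate
    (F := fun (z u : E) (ω : Ω) => localMisfit A δ 0 η z ω * reach η z u ω) hF,
    ← lintegral_const_mul _ (hη.measurable_totalMisfit hA δ d)]
  refine lintegral_mono fun ω => ?_
  refine le_trans (lintegral_mono fun z => le_of_eq ?_)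
    (hη.lintegral_localMisfit_mul_lintegral_reach_le hA hd hδ ω)
  have hN : Measurable fun u => reach η z u ω :=
    hη.measurable_reach_comp measurable_const measurable_id measurable_const
  exact lintegral_const_mul _ hN

/-- The two expectations are separate, so the reaching term and the product are not tied to the same
configuration; they are coupled only through the position `w i`. -/
theorem lintegral_reach_mul_copy_le [SFinite P] (hη : IsHomogeneousPoissonProcess P lam η)
    (hA : MeasurableSet A) (hd : 1 ≤ d) (hδ : 0 < δ) {k : ℕ} (i : Fin (k + 1)) :
    ∫⁻ z, ∫⁻ w : Fin (k + 1) → E, (∫⁻ ω, localMisfit A δ 0 η z ω * reach η z (w i) ω ∂P) *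
        (∫⁻ ω, ∏ j, localMisfit A δ 0 η (w j) ω ∂P) ≤
      reachConst d * (δ : ℝ≥0∞) ^ d *
        ((∫⁻ ω, totalMisfit A δ d η ω ∂P) * ∫⁻ ω, totalMisfit A δ 0 η ω ^ k ∂P) := by
  have hF : Measurable fun p : E × E × Ω => localMisfit A δ 0 η p.1 p.2.2 *
      reach η p.1 p.2.1 p.2.2 :=
    (hη.measurable_localMisfit_comp hA δ 0 (by fun_prop) (by fun_prop)).mul
      (hη.measurable_reach_comp (by fun_prop) (by fun_prop) (by fun_prop))
  have hG : Measurable fun p : E × E =>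
      ∫⁻ ω, localMisfit A δ 0 η p.1 ω * reach η p.1 p.2 ω ∂P :=
    measurable_lintegral_last (ρ := P)
      (F := fun (z u : E) (ω : Ω) => localMisfit A δ 0 η z ω * reach η z u ω) hF
  calc _ ≤ ∫⁻ z, (∫⁻ u, ∫⁻ ω, localMisfit A δ 0 η z ω * reach η z u ω ∂P) *
        ∫⁻ ω, totalMisfit A δ 0 η ω ^ k ∂P :=
        lintegral_mono fun z => hη.lintegral_mul_lintegral_prod_le hA δ i
          (g := fun u => ∫⁻ ω, localMisfit A δ 0 η z ω * reach η z u ω ∂P)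
          (hG.comp measurable_prodMk_left)
    _ = (∫⁻ z, ∫⁻ u, ∫⁻ ω, localMisfit A δ 0 η z ω * reach η z u ω ∂P) *
        ∫⁻ ω, totalMisfit A δ 0 η ω ^ k ∂P := lintegral_mul_const _ hG.lintegral_prod_right'
    _ ≤ _ := by
        rw [← mul_assoc]
        exact mul_le_mul_left (hη.lintegral_lintegral_reach_le hA hd hδ) _

/-- The reverse of `lintegral_totalMisfit_pow_le` for the unweighted volume. -/
theorem mul_lintegral_totalMisfit_pow_le [IsProbabilityMeasure P]
    (hη : IsHomogeneousPoissonProcess P lam η)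
    (hA : MeasurableSet A) (hd : 1 ≤ d) (hδ : 0 < δ) (k : ℕ) :
    (∫⁻ ω, totalMisfit A δ 0 η ω ∂P) * (∫⁻ ω, totalMisfit A δ 0 η ω ^ (k + 1) ∂P) ≤
      ∫⁻ ω, totalMisfit A δ 0 η ω ^ (k + 2) ∂P
      + (k + 1) * (reachConst d * (δ : ℝ≥0∞) ^ d *
        ((∫⁻ ω, totalMisfit A δ d η ω ∂P) * (∫⁻ ω, totalMisfit A δ 0 η ω ^ k ∂P)
          + ∫⁻ ω, totalMisfit A δ d η ω ^ (k + 1) ∂P)) := by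
  have hX : Measurable fun p : E × (Fin (k + 1) → E) × Ω => localMisfit A δ 0 η p.1 p.2.2 :=
    hη.measurable_localMisfit_comp hA δ 0 (by fun_prop) (by fun_prop)
  have hY : Measurable fun p : E × (Fin (k + 1) → E) × Ω =>
      ∏ j, localMisfit A δ 0 η (p.2.1 j) p.2.2 :=
    hη.measurable_prod_localMisfit_comp hA δ 0 (by fun_prop) (by fun_prop)
  have hN : ∀ i, Measurable fun p : E × (Fin (k + 1) → E) × Ω => reach η p.1 (p.2.1 i) p.2.2 :=
    fun i => hη.measurable_reach_comp (by fun_prop) (by fun_prop) (by fun_prop)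
  have hN' : ∀ i, Measurable fun p : E × (Fin (k + 1) → E) × Ω => reach η (p.2.1 i) p.1 p.2.2 :=
    fun i => hη.measurable_reach_comp (by fun_prop) (by fun_prop) (by fun_prop)
  have ha : Measurable fun z => ∫⁻ ω, localMisfit A δ 0 η z ω ∂P :=
    (hη.measurable_localMisfit hA δ 0).lintegral_prod_right'
  have hb : Measurable fun w : Fin (k + 1) → E => ∫⁻ ω, ∏ j, localMisfit A δ 0 η (w j) ω ∂P :=
    (hη.measurable_prod_localMisfit_comp hA δ 0 measurable_fst measurable_snd).lintegral_prod_right'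
  have hc1 : ∀ i, Measurable fun p : E × (Fin (k + 1) → E) =>
      (∫⁻ ω, localMisfit A δ 0 η p.1 ω * reach η p.1 (p.2 i) ω ∂P) *
        (∫⁻ ω, ∏ j, localMisfit A δ 0 η (p.2 j) ω ∂P) := fun i =>
    (measurable_lintegral_last (ρ := P) (F := fun (z : E) (w : Fin (k + 1) → E) (ω : Ω) => localMisfit A δ 0 η z ω * reach η z (w i) ω)
      (hX.mul (hN i))).mul (hb.comp measurable_snd)
  have hc2 : ∀ i, Measurable fun p : E × (Fin (k + 1) → E) =>
      ∫⁻ ω, (∏ j, localMisfit A δ 0 η (p.2 j) ω) * reach η (p.2 i) p.1 ω ∂P := fun i =>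
    measurable_lintegral_last (ρ := P) (F := fun (z : E) (w : Fin (k + 1) → E) (ω : Ω) =>
      (∏ j, localMisfit A δ 0 η (w j) ω) * reach η (w i) z ω) (hY.mul (hN' i))
  have hstart : (∫⁻ ω, totalMisfit A δ 0 η ω ∂P) * (∫⁻ ω, totalMisfit A δ 0 η ω ^ (k + 1) ∂P)
      = ∫⁻ z, ∫⁻ w : Fin (k + 1) → E, (∫⁻ ω, localMisfit A δ 0 η z ω ∂P) *
        (∫⁻ ω, ∏ j, localMisfit A δ 0 η (w j) ω ∂P) := by
    simp_rw [lintegral_const_mul _ hb, lintegral_mul_const _ ha]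
    rw [hη.lintegral_localMisfit hA, hη.lintegral_prod_localMisfit hA]
  rw [hstart]
  refine (lintegral_mono fun z => lintegral_mono fun w =>
    hη.mul_lintegral_prod_le hA δ z w).trans ?_
  rw [lintegral_lintegral_add_sum (measurable_lintegral_last (ρ := P) (F := fun (z : E) (w : Fin (k + 1) → E) (ω : Ω) =>
      localMisfit A δ 0 η z ω * ∏ j, localMisfit A δ 0 η (w j) ω) (hX.mul hY))
    fun i => (hc1 i).add (hc2 i), hη.lintegral_mul_prod_localMisfit hA δ 0 (k + 1)]
  gcongr
  have hV := (hη.measurable_totalMisfit hA δ d).pow_const (k + 1)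
  calc _ ≤ ∑ _ : Fin (k + 1), (reachConst d * (δ : ℝ≥0∞) ^ d *
        ((∫⁻ ω, totalMisfit A δ d η ω ∂P) * (∫⁻ ω, totalMisfit A δ 0 η ω ^ k ∂P)
          + ∫⁻ ω, totalMisfit A δ d η ω ^ (k + 1) ∂P)) := by
        refine Finset.sum_le_sum fun i _ => ?_
        rw [lintegral_lintegral_add (hc1 i), mul_add]
        refine add_le_add ?_ ?_
        · exact hη.lintegral_reach_mul_copy_le hA hd hδ i
        · rw [lintegral_lintegral_lintegral_rotate (F := fun (z : E) (w : Fin (k + 1) → E) (ω : Ω) =>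
            (∏ j, localMisfit A δ 0 η (w j) ω) * reach η (w i) z ω) (hY.mul (hN' i)), ← lintegral_const_mul _ hV]
          exact lintegral_mono fun ω => hη.lintegral_prod_mul_reach_le hA hd hδ i ω
    _ = _ := by
        rw [Finset.sum_const, Finset.card_univ, Fintype.card_fin, nsmul_eq_mul]
        push_cast
        rfl

end IsHomogeneousPoissonProcess

end Covariance

/-! ### Abstract recursions for moments -/

section Recursion

/-- Moments that nearly factorise are of the order of the powers of the mean. -/
theorem exists_moment_bound {K₁ : ℕ → ℝ≥0∞} {K₂ : ℕ → ℕ → ℝ≥0∞} (hK₁ : ∀ q, K₁ q ≠ ∞)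
    (hK₂ : ∀ k q, K₂ k q ≠ ∞) (s : ℕ → ℕ) {c : ℝ≥0∞} (hc : c ≠ ∞) (m q : ℕ) :
    ∃ C : ℝ≥0∞, C ≠ ∞ ∧ ∀ (b : ℕ → ℕ → ℝ≥0∞) (x y : ℝ≥0∞), (∀ q, b 0 q ≤ 1) →
      (∀ q, b 1 q ≤ K₁ q * x) →
      (∀ k q, b (k + 2) q ≤ b 1 q * b (k + 1) q + K₂ k q * (y * b (k + 1) (s q))) →
      y ≤ c * x → b m q ≤ C * x ^ m := by
  -- The error term calls for the lower moment at exponent `s q`, so the induction needs all `q`.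
  induction m generalizing q with
  | zero => exact ⟨1, by simp, fun b x y h0 _ _ _ => by simpa using h0 q⟩
  | succ m ih =>
    rcases m with _ | k
    · exact ⟨K₁ q, hK₁ q, fun b x y _ h1 _ _ => by simpa using h1 q⟩
    · obtain ⟨C, hC, hCb⟩ := ih q
      obtain ⟨D, hD, hDb⟩ := ih (s q)
      refine ⟨K₁ q * C + K₂ k q * (c * D), ENNReal.add_ne_top.2 ⟨ENNReal.mul_ne_top (hK₁ q) hC,
        ENNReal.mul_ne_top (hK₂ k q) (ENNReal.mul_ne_top hc hD)⟩, fun b x y h0 h1 h2 hy => ?_⟩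
      calc b (k + 2) q ≤ b 1 q * b (k + 1) q + K₂ k q * (y * b (k + 1) (s q)) := h2 k q
        _ ≤ K₁ q * x * (C * x ^ (k + 1)) + K₂ k q * (c * x * (D * x ^ (k + 1))) := by
          gcongr
          · exact h1 q
          · exact hCb b x y h0 h1 h2 hy
          · exact hDb b x y h0 h1 h2 hy
        _ = _ := by ring

/-- Here `b m q` stands for the `m`-th moment with weight exponent `q`, `x` for `Per(A) δ` and `y`
for `δ^d`. Multiplying the estimate for one power by the mean, of order `x`, gives the main error;
the new one is of order `x^(k+1) y` by `exists_moment_bound`. -/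
theorem exists_moment_sub_pow_bound {K₁ : ℕ → ℝ≥0∞} {K₂ : ℕ → ℕ → ℝ≥0∞} {K₃ : ℕ → ℝ≥0∞}
    (hK₁ : ∀ q, K₁ q ≠ ∞) (hK₂ : ∀ k q, K₂ k q ≠ ∞) (hK₃ : ∀ k, K₃ k ≠ ∞) (s : ℕ → ℕ) (d : ℕ)
    {c : ℝ≥0∞} (hc : c ≠ ∞) (k : ℕ) :
    ∃ C : ℝ≥0∞, C ≠ ∞ ∧ ∀ (b : ℕ → ℕ → ℝ≥0∞) (x y : ℝ≥0∞), (∀ q, b 0 q ≤ 1) →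
      (∀ q, b 1 q ≤ K₁ q * x) →
      (∀ k q, b (k + 2) q ≤ b 1 q * b (k + 1) q + K₂ k q * (y * b (k + 1) (s q))) →
      (∀ k, b 1 0 * b (k + 1) 0 ≤ b (k + 2) 0 + K₃ k * (y * (b 1 d * b k 0 + b (k + 1) d))) →
      y ≤ c * x → b (k + 1) 0 ≤ b 1 0 ^ (k + 1) + C * (x ^ k * y) ∧
        b 1 0 ^ (k + 1) ≤ b (k + 1) 0 + C * (x ^ k * y) := by
  induction k with
  | zero => exact ⟨0, by simp, fun b x y _ _ _ _ _ => by simp⟩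
  | succ k ih =>
    obtain ⟨C, hC, hCb⟩ := ih
    obtain ⟨C₁, hC₁, hCb₁⟩ := exists_moment_bound hK₁ hK₂ s hc (k + 1) (s 0)
    obtain ⟨C₂, hC₂, hCb₂⟩ := exists_moment_bound hK₁ hK₂ s hc k 0
    obtain ⟨C₃, hC₃, hCb₃⟩ := exists_moment_bound hK₁ hK₂ s hc (k + 1) d
    refine ⟨K₁ 0 * C + K₂ k 0 * C₁ + K₃ k * (K₁ d * C₂ + C₃), ?_, fun b x y h0 h1 h2 h3 hy => ?_⟩
    · exact ENNReal.add_ne_top.2 ⟨ENNReal.add_ne_top.2 ⟨ENNReal.mul_ne_top (hK₁ 0) hC,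
        ENNReal.mul_ne_top (hK₂ k 0) hC₁⟩, ENNReal.mul_ne_top (hK₃ k)
        (ENNReal.add_ne_top.2 ⟨ENNReal.mul_ne_top (hK₁ d) hC₂, hC₃⟩)⟩
    · obtain ⟨hu, hl⟩ := hCb b x y h0 h1 h2 h3 hy
      constructor
      · calc b (k + 2) 0 ≤ b 1 0 * b (k + 1) 0 + K₂ k 0 * (y * b (k + 1) (s 0)) := h2 k 0
          _ ≤ b 1 0 * (b 1 0 ^ (k + 1) + C * (x ^ k * y)) + K₂ k 0 * (y * (C₁ * x ^ (k + 1))) := by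
            gcongr
            exact hCb₁ b x y h0 h1 h2 hy
          _ = b 1 0 ^ (k + 2) + b 1 0 * (C * (x ^ k * y)) + K₂ k 0 * (y * (C₁ * x ^ (k + 1))) := by
            ring
          _ ≤ b 1 0 ^ (k + 2) + K₁ 0 * x * (C * (x ^ k * y))
              + K₂ k 0 * (y * (C₁ * x ^ (k + 1))) := by
            gcongr
            exact h1 0
          _ = b 1 0 ^ (k + 2) + (K₁ 0 * C + K₂ k 0 * C₁) * (x ^ (k + 1) * y) := by ring
          _ ≤ _ := add_le_add le_rfl (mul_le_mul_left le_self_add _)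
      · calc b 1 0 ^ (k + 2) = b 1 0 * b 1 0 ^ (k + 1) := by ring
          _ ≤ b 1 0 * (b (k + 1) 0 + C * (x ^ k * y)) := by gcongr
          _ = b 1 0 * b (k + 1) 0 + b 1 0 * (C * (x ^ k * y)) := by ring
          _ ≤ b (k + 2) 0 + K₃ k * (y * (K₁ d * x * (C₂ * x ^ k) + C₃ * x ^ (k + 1)))
              + K₁ 0 * x * (C * (x ^ k * y)) := by
            refine add_le_add ((h3 k).trans ?_) (mul_le_mul_left (h1 0) _)
            gcongr
            · exact h1 d
            · exact hCb₂ b x y h0 h1 h2 hy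
            · exact hCb₃ b x y h0 h1 h2 hy
          _ = b (k + 2) 0 + (K₁ 0 * C + K₃ k * (K₁ d * C₂ + C₃)) * (x ^ (k + 1) * y) := by ring
          _ ≤ _ := by
            refine add_le_add le_rfl (mul_le_mul_left ?_ _)
            rw [add_right_comm]
            exact le_self_add

end Recursion

/-! ### Moment estimates for the approximation -/

section Moments

theorem memLp_toReal_and_abs_sub_le {Ω : Type*} [MeasurableSpace Ω] {P : Measure Ω}
    {V : Ω → ℝ≥0∞} (hV : Measurable V) {k : ℕ} {e : ℝ≥0∞} (he : e ≠ ∞)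
    (hfin : ∫⁻ ω, V ω ^ (k + 1) ∂P ≠ ∞) (hmean : ∫⁻ ω, V ω ∂P ≠ ∞)
    (hu : ∫⁻ ω, V ω ^ (k + 1) ∂P ≤ (∫⁻ ω, V ω ∂P) ^ (k + 1) + e)
    (hl : (∫⁻ ω, V ω ∂P) ^ (k + 1) ≤ ∫⁻ ω, V ω ^ (k + 1) ∂P + e) :
    (∀ᵐ ω ∂P, V ω < ∞) ∧ MemLp (fun ω => (V ω).toReal) (k + 1 : ℕ) P ∧
      |(∫ ω, (V ω).toReal ^ (k + 1) ∂P) - (∫ ω, (V ω).toReal ∂P) ^ (k + 1)| ≤ e.toReal := by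
  have hae : ∀ᵐ ω ∂P, V ω < ∞ := ae_lt_top hV hmean
  refine ⟨hae, ⟨hV.ennreal_toReal.aestronglyMeasurable, ?_⟩, ?_⟩
  · rw [eLpNorm_lt_top_iff_lintegral_rpow_enorm_lt_top (by simp) (by simp)]
    refine lt_of_eq_of_lt (lintegral_congr_ae ?_) hfin.lt_top
    filter_upwards [hae] with ω hω
    rw [Real.enorm_eq_ofReal ENNReal.toReal_nonneg, ENNReal.ofReal_toReal hω.ne]
    rw [ENNReal.toReal_natCast, ENNReal.rpow_natCast]
  · simp_rw [← ENNReal.toReal_pow]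
    rw [integral_toReal hV.aemeasurable hae, integral_toReal (hV.pow_const _).aemeasurable
      (hae.mono fun ω hω => ENNReal.pow_lt_top hω), ← ENNReal.toReal_pow, abs_le]
    have hp : (∫⁻ ω, V ω ∂P) ^ (k + 1) ≠ ∞ := ENNReal.pow_ne_top hmean
    have h1 := ENNReal.toReal_mono (ENNReal.add_ne_top.2 ⟨hp, he⟩) hu
    have h2 := ENNReal.toReal_mono (ENNReal.add_ne_top.2 ⟨hfin, he⟩) hl
    rw [ENNReal.toReal_add hp he] at h1
    rw [ENNReal.toReal_add hfin he] at h2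
    constructor <;> linarith

/-- The recursion applies once `δ^d ≤ c Per(A) δ`. The constant `c` depends only on `d`; `A` enters
only through the threshold `r`, below which this comparison holds. -/
theorem exists_totalMisfit_bound (d k : ℕ) (hd : 1 ≤ d) :
    ∃ C : ℝ≥0∞, C ≠ ∞ ∧ ∀ A : Set (EuclideanSpace ℝ (Fin d)), MeasurableSet A → volume A < ∞ →
      perimeter A < ∞ → ∃ r : ℝ≥0, 0 < r ∧ ∀ (Ω : Type*) [MeasurableSpace Ω] (P : Measure Ω)
        [IsProbabilityMeasure P] (η : Ω → Set (EuclideanSpace ℝ (Fin d))) (lam : ℝ) (δ : ℝ≥0),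
        IsHomogeneousPoissonProcess P lam η → lam * (δ : ℝ) ^ d = 1 → δ ≤ r →
        ∫⁻ ω, totalMisfit A δ 0 η ω ^ (k + 1) ∂P ≤ (∫⁻ ω, totalMisfit A δ 0 η ω ∂P) ^ (k + 1)
            + C * ((perimeter A * δ) ^ k * (δ : ℝ≥0∞) ^ d) ∧
        (∫⁻ ω, totalMisfit A δ 0 η ω ∂P) ^ (k + 1) ≤ ∫⁻ ω, totalMisfit A δ 0 η ω ^ (k + 1) ∂P
            + C * ((perimeter A * δ) ^ k * (δ : ℝ≥0∞) ^ d) := by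
  have hκ : volume (Metric.ball (0 : EuclideanSpace ℝ (Fin d)) 1) ≠ 0 :=
    (Metric.measure_ball_pos _ _ one_pos).ne'
  have hκt : volume (Metric.ball (0 : EuclideanSpace ℝ (Fin d)) 1) ≠ ∞ := measure_ball_lt_top.ne
  have hR := reachConst_ne_top d
  obtain ⟨C, hC, hCb⟩ := exists_moment_sub_pow_bound (K₁ := meanConst d)
    (K₂ := fun k q => (k + 1) * (2 * 3 ^ q * reachConst d)) (K₃ := fun k => (k + 1) * reachConst d)
    (meanConst_ne_top d)
    (fun k q => ENNReal.mul_ne_top (by simp) (ENNReal.mul_ne_top (ENNReal.mul_ne_top (by simp)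
      (by simp)) hR)) (fun k => ENNReal.mul_ne_top (by simp) hR) (fun q => 2 * q + d) d
    (c := 6 / volume (Metric.ball (0 : EuclideanSpace ℝ (Fin d)) 1))
    (ENNReal.div_ne_top (by simp) hκ) k
  refine ⟨C, hC, fun A hA hfin hper => ?_⟩
  have hδpos : ∀ {lam : ℝ} {δ : ℝ≥0}, lam * (δ : ℝ) ^ d = 1 → 0 < δ := fun {lam δ} h => by
    rw [pos_iff_ne_zero]; rintro rfl
    simp [zero_pow (by omega : d ≠ 0)] at h
  -- For a null set the perimeter is `0` and the comparison fails, but the mean bound makes the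
  -- misplaced volume vanish almost surely.
  by_cases hA0 : volume A = 0
  · refine ⟨1, one_pos, fun Ω _ P _ η lam δ hη hδ _ => ?_⟩
    have h1 : ∫⁻ ω, totalMisfit A δ 0 η ω ∂P = 0 := by
      have := hη.lintegral_totalMisfit_le hδ hd hA hfin 0
      rw [perimeter_eq_zero_of_measure_zero hA0, zero_mul, mul_zero] at this
      exact le_antisymm this zero_le
    have h2 : ∫⁻ ω, totalMisfit A δ 0 η ω ^ (k + 1) ∂P = 0 := by
      rw [lintegral_eq_zero_iff (hη.measurable_totalMisfit hA δ 0)] at h1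
      rw [lintegral_eq_zero_iff ((hη.measurable_totalMisfit hA δ 0).pow_const _)]
      filter_upwards [h1] with ω hω
      simp [hω]
    rw [h1, h2]
    simp
  · obtain ⟨r, hr, hrb⟩ := exists_pow_le_perimeter hd hA hfin hA0
    refine ⟨r, hr, fun Ω _ P _ η lam δ hη hδ hδr => ?_⟩
    have hδ0 := hδpos hδ
    have := hCb (fun m q => ∫⁻ ω, totalMisfit A δ q η ω ^ m ∂P) (perimeter A * δ)
      ((δ : ℝ≥0∞) ^ d) (fun q => by simp)
      (fun q => by simpa using hη.lintegral_totalMisfit_le hδ hd hA hfin q)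
      (fun k q => by
        simp only [pow_one]
        refine (hη.lintegral_totalMisfit_pow_le hA hd hδ0 q k).trans (le_of_eq ?_)
        ring)
      (fun k => by
        simp only [pow_one]
        refine (hη.mul_lintegral_totalMisfit_pow_le hA hd hδ0 k).trans (le_of_eq ?_)
        ring) ?_
    · simpa only [pow_one] using this
    · obtain ⟨j, rfl⟩ : ∃ j, d = j + 1 := ⟨d - 1, by omega⟩
      have hr0 : (r : ℝ≥0∞) ≠ 0 := by exact_mod_cast hr.ne'
      set κ := volume (Metric.ball (0 : EuclideanSpace ℝ (Fin (j + 1))) 1)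
      -- Cancelling one factor `r` leaves `r^(d-1)`, which dominates `δ^(d-1)` for `δ ≤ r`.
      have h1 : (r : ℝ≥0∞) ^ j * κ ≤ 6 * perimeter A := by
        rw [← ENNReal.mul_le_mul_iff_right hr0 ENNReal.coe_ne_top]
        calc (r : ℝ≥0∞) * ((r : ℝ≥0∞) ^ j * κ) = (r : ℝ≥0∞) ^ (j + 1) * κ := by ring
          _ ≤ _ := hrb
          _ = _ := by ring
      calc (δ : ℝ≥0∞) ^ (j + 1) = (δ : ℝ≥0∞) ^ j * δ := pow_succ _ _
        _ ≤ (r : ℝ≥0∞) ^ j * δ := by gcongr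
        _ ≤ (6 * perimeter A / κ) * δ := by
          gcongr
          rwa [ENNReal.le_div_iff_mul_le (Or.inl hκ) (Or.inl hκt)]
        _ = _ := by simp only [div_eq_mul_inv]; ring

end Moments

end PoissonVoronoi

/-! ### The theorem -/

theorem theorem0037 (d n : ℕ) (hd : 1 ≤ d) (hn : 1 ≤ n) :
    ∃ C : ℝ, ∀ A : Set (EuclideanSpace ℝ (Fin d)), MeasurableSet A →
      volume A < ∞ → PoissonVoronoi.perimeter A < ∞ →
      ∃ lam₀ : ℝ, 0 < lam₀ ∧ ∀ lam : ℝ, lam₀ ≤ lam →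
        ∀ (Ω : Type*) [MeasurableSpace Ω] (P : Measure Ω) [IsProbabilityMeasure P]
          (η : Ω → Set (EuclideanSpace ℝ (Fin d))),
          PoissonVoronoi.IsHomogeneousPoissonProcess P lam η →
          (∀ᵐ ω ∂P, volume (A ∆ PoissonVoronoi.voronoiApprox A (η ω)) < ∞) ∧
          MemLp (fun ω => volume.real (A ∆ PoissonVoronoi.voronoiApprox A (η ω))) n P ∧
          |(∫ ω, volume.real (A ∆ PoissonVoronoi.voronoiApprox A (η ω)) ^ n ∂P)
              - (∫ ω, volume.real (A ∆ PoissonVoronoi.voronoiApprox A (η ω)) ∂P) ^ n|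
            ≤ C * (PoissonVoronoi.perimeter A).toReal ^ (n - 1)
                * lam ^ (-1 - ((n : ℝ) - 1) / (d : ℝ)) := by
  obtain ⟨k, rfl⟩ : ∃ k, n = k + 1 := ⟨n - 1, by omega⟩
  obtain ⟨C, hC, hCb⟩ := PoissonVoronoi.exists_totalMisfit_bound d k hd
  refine ⟨C.toReal, fun A hA hfin hper => ?_⟩
  obtain ⟨r, hr, hrb⟩ := hCb A hA hfin hper
  have hd0 : (d : ℝ) ≠ 0 := by exact_mod_cast (by omega : d ≠ 0)
  have hr' : (0 : ℝ) < r := hr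
  -- The threshold is the intensity at which `lam ^ (-1/d)` equals `r`.
  refine ⟨(r : ℝ) ^ (-(d : ℝ)), by positivity, fun lam hlam Ω _ P _ η hη => ?_⟩
  have hl := hη.intensity_pos
  let δ : ℝ≥0 := ⟨lam ^ (-(1 / (d : ℝ))), by positivity⟩
  have hδ : (δ : ℝ) = lam ^ (-(1 / (d : ℝ))) := rfl
  have hpow : ∀ m : ℕ, (δ : ℝ) ^ m = lam ^ (-(m / (d : ℝ))) := fun m => by
    rw [hδ, ← Real.rpow_natCast, ← Real.rpow_mul hl.le]
    congr 1
    ring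
  have hδd : lam * (δ : ℝ) ^ d = 1 := by
    rw [hpow, div_self hd0, Real.rpow_neg_one, mul_inv_cancel₀ hl.ne']
  have hδr : δ ≤ r := by
    rw [← NNReal.coe_le_coe, hδ]
    calc lam ^ (-(1 / (d : ℝ))) ≤ ((r : ℝ) ^ (-(d : ℝ))) ^ (-(1 / (d : ℝ))) :=
          Real.rpow_le_rpow_of_nonpos (by positivity) hlam (by
            rw [neg_nonpos]; positivity)
      _ = r := by
          rw [← Real.rpow_mul hr'.le, neg_mul_neg, mul_one_div_cancel hd0, Real.rpow_one]
  obtain ⟨hu, hlow⟩ := hrb Ω P η lam δ hη hδd hδr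
  have hV : ∀ ω, volume (A ∆ PoissonVoronoi.voronoiApprox A (η ω))
      = PoissonVoronoi.totalMisfit A δ 0 η ω := fun ω =>
    (PoissonVoronoi.totalMisfit_zero hA δ fun B hB => hη.locallyFinite ω B hB).symm
  simp only [measureReal_def, hV]
  have he : C * ((PoissonVoronoi.perimeter A * δ) ^ k * (δ : ℝ≥0∞) ^ d) ≠ ∞ :=
    ENNReal.mul_ne_top hC (ENNReal.mul_ne_top (ENNReal.pow_ne_top
      (ENNReal.mul_ne_top hper.ne ENNReal.coe_ne_top)) (ENNReal.pow_ne_top ENNReal.coe_ne_top))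
  have hmean : ∫⁻ ω, PoissonVoronoi.totalMisfit A δ 0 η ω ∂P ≠ ∞ :=
    ((hη.lintegral_totalMisfit_le hδd hd hA hfin 0).trans_lt (ENNReal.mul_lt_top
      (PoissonVoronoi.meanConst_ne_top d 0).lt_top
      (ENNReal.mul_lt_top hper ENNReal.coe_lt_top))).ne
  have hmom : ∫⁻ ω, PoissonVoronoi.totalMisfit A δ 0 η ω ^ (k + 1) ∂P ≠ ∞ :=
    (hu.trans_lt (ENNReal.add_lt_top.2 ⟨(ENNReal.pow_ne_top hmean).lt_top, he.lt_top⟩)).ne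
  obtain ⟨h1, h2, h3⟩ := PoissonVoronoi.memLp_toReal_and_abs_sub_le
    (hη.measurable_totalMisfit hA δ 0) he hmom hmean hu hlow
  refine ⟨h1, h2, h3.trans (le_of_eq ?_)⟩
  have hexp : lam ^ (-1 - (((k + 1 : ℕ) : ℝ) - 1) / (d : ℝ)) = (δ : ℝ) ^ k * (δ : ℝ) ^ d := by
    rw [← pow_add, hpow]
    congr 1
    push_cast
    field_simp
    ring
  rw [hexp, Nat.add_sub_cancel, ENNReal.toReal_mul, ENNReal.toReal_mul, ENNReal.toReal_pow,
    ENNReal.toReal_pow, ENNReal.toReal_mul, ENNReal.coe_toReal, mul_pow]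
  ring
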